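/- Let $N\ge 1$, let $Q=(0,1)^N$ and let all functions be complex-valued. Let $H^1(T^N)$ be the space of periodic functions in $H^1(Q)$ (i.e. those $u\in H^1(Q)$ for which $\int_Q u\,\partial_i\varphi\,dx=-\int_Q \partial_i u\,\varphi\,dx$ for all smooth $\mathbb Z^N$-periodic $\varphi$ and all $i$), and let $H^{-1}(T^N)$ be the space of bounded antilinear functionals on $H^1(T^N)$; $f\in L^2(Q)$ is identified with the functional $\langle f,v\rangle=\int_Q f\bar v\,dx$. Let $$\mathrm{Har}(Q)=\Big\{u\in H^1(Q):\int_Q\nabla u\cdot\nabla\bar v\,dx=0\ \ \forall v\in H^1_0(Q)\Big\},\qquad \mathrm{Har}(T^N)=\Big\{u\in H^1(T^N):\int_Q\nabla u\cdot\nabla\bar v\,dx=0\ \ \forall v\in H^1_0(Q)\Big\},$$ and let $$V=\{f\in L^2(Q): (f|g)_{L^2}=0\ \ \forall g\in\mathrm{Har}(Q)\},\qquad \tilde V=\{f\in L^2(Q): (f|g)_{L^2}=0\ \ \forall g\in\mathrm{Har}(T^N)\},$$ $$H=\{w\in H^{-1}(T^N):\langle w,v\rangle=0\ \ \forall v\in\mathrm{Har}(T^N)\}.$$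 For $w\in H$ let $u_w\in H^1(T^N)$ be the unique function with $\int_Q u_w\,dx=0$ and $\int_Q\nabla u_w\cdot\nabla\bar v\,dx=-\langle w,v\rangle$ for all $v\in H^1(T^N)$. Endow $H$ with the inner product $(w|z)_H=\int_Q\nabla u_w\cdot\nabla\bar u_z\,dx$; its norm is equivalent to the norm of $H^{-1}(T^N)$. The spaces $V\subset\tilde V$ are embedded in $H$. Let $A$ and $\tilde A$ be the operators on $H$ associated with the form $a(f,h)=\int_Q f\bar h\,dx$ with form domain $V$ and $\tilde V$, respectively, that is, $$D(A)=\{f\in V:\exists g\in H\ \ a(f,h)=(g|h)_H\ \ \forall h\in V\},\quad Af=g,$$ $$D(\tilde A)=\{f\in \tilde V:\exists g\in H\ \ a(f,h)=(g|h)_H\ \ \forall h\in \tilde V\},\quad \tilde Af=g.$$ Then both $-A$ and $-\tilde A$ generate strongly continuous semigroups on $H$ that are analytic, contractive (with respect to the norm of $(\cdot|\cdot)_H$) and exponentially stable. -/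

import Mathlib

open MeasureTheory Set Filter Topology Complex
open scoped ContDiff ComplexConjugate ENNReal NNReal

noncomputable section

namespace MomentHeat

/-! ### Function spaces on the cube `(0,1)^N` -/

/-- The open unit cube `(0,1)^N`. -/
def cube (N : ℕ) : Set (Fin N → ℝ) := {x | ∀ i, x i ∈ Ioo (0 : ℝ) 1}

/-- The complex Hilbert space `L²((0,1)^N)`. -/
abbrev L2 (N : ℕ) : Type := Lp ℂ 2 (volume.restrict (cube N))

/-- The `i`-th partial derivative of a function on `ℝ^N`. -/
def pderiv {N : ℕ} (i : Fin N) (φ : (Fin N → ℝ) → ℂ) (x : Fin N → ℝ) : ℂ :=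
  fderiv ℝ φ x (Pi.single i 1)

/-- Test functions: smooth functions with compact support contained in `(0,1)^N`. -/
def IsTest {N : ℕ} (φ : (Fin N → ℝ) → ℂ) : Prop :=
  ContDiff ℝ ∞ φ ∧ HasCompactSupport φ ∧ tsupport φ ⊆ cube N

/-- Smooth functions on the torus, i.e. smooth `ℤ^N`-periodic functions on `ℝ^N`. -/
def IsPeriodicSmooth {N : ℕ} (φ : (Fin N → ℝ) → ℂ) : Prop :=
  ContDiff ℝ ∞ φ ∧ ∀ (x : Fin N → ℝ) (i : Fin N), φ (x + Pi.single i 1) = φ x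

/-- Pairs `(u, g)` of a function `u ∈ L²` and a vector field `g ∈ (L²)^N`, with the Hilbert space
norm `(‖u‖² + ∑ i, ‖g i‖²)^(1/2)`. Sobolev functions are identified with the pairs `(u, ∇u)`. -/
def Pairs (N : ℕ) : Type := WithLp 2 (L2 N × PiLp 2 (fun _ : Fin N => L2 N))

instance instNormedPairs (N : ℕ) : NormedAddCommGroup (Pairs N) :=
  inferInstanceAs (NormedAddCommGroup (WithLp 2 (L2 N × PiLp 2 (fun _ : Fin N => L2 N))))

instance instInnerPairs (N : ℕ) : InnerProductSpace ℂ (Pairs N) :=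
  inferInstanceAs (InnerProductSpace ℂ (WithLp 2 (L2 N × PiLp 2 (fun _ : Fin N => L2 N))))

instance instCompletePairs (N : ℕ) : CompleteSpace (Pairs N) :=
  inferInstanceAs (CompleteSpace (WithLp 2 (L2 N × PiLp 2 (fun _ : Fin N => L2 N))))

/-- The function `u` of a pair `(u, g)`. -/
def fn {N : ℕ} : Pairs N →L[ℂ] L2 N := WithLp.fstL 2 ℂ (L2 N) (PiLp 2 (fun _ : Fin N => L2 N))

/-- The vector field `g` of a pair `(u, g)`. -/
def grad {N : ℕ} : Pairs N →L[ℂ] PiLp 2 (fun _ : Fin N => L2 N) :=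
  WithLp.sndL 2 ℂ (L2 N) (PiLp 2 (fun _ : Fin N => L2 N))

/-- The pair `(u, g)`. -/
def mkPair {N : ℕ} (u : L2 N) (g : PiLp 2 (fun _ : Fin N => L2 N)) : Pairs N := WithLp.toLp 2 (u, g)

@[simp] lemma fn_mkPair {N : ℕ} (u : L2 N) (g : PiLp 2 (fun _ : Fin N => L2 N)) :
    fn (mkPair u g) = u := rfl

@[simp] lemma grad_mkPair {N : ℕ} (u : L2 N) (g : PiLp 2 (fun _ : Fin N => L2 N)) :
    grad (mkPair u g) = g := rfl

lemma norm_sq_pair {N : ℕ} (p : Pairs N) : ‖p‖ ^ 2 = ‖fn p‖ ^ 2 + ‖grad p‖ ^ 2 :=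
  WithLp.prod_norm_sq_eq_of_L2 p

/-- The integration by parts identity (without boundary terms) for the pair `(u, g)` against `φ`. -/
def IBP {N : ℕ} (p : Pairs N) (φ : (Fin N → ℝ) → ℂ) : Prop :=
  ∀ i : Fin N, ∫ x in cube N, fn p x * pderiv i φ x = - ∫ x in cube N, grad p i x * φ x

lemma isOpen_cube (N : ℕ) : IsOpen (cube N) := by
  have : cube N = Set.pi univ (fun _ => Ioo (0 : ℝ) 1) := by ext; simp [cube]
  rw [this]; exact isOpen_set_pi finite_univ (fun _ _ => isOpen_Ioo)

lemma cube_ae_eq_Icc (N : ℕ) : (cube N : Set (Fin N → ℝ)) =ᵐ[volume] Icc 0 1 := by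
  have : cube N = Set.pi univ (fun i => Ioo ((0 : Fin N → ℝ) i) ((1 : Fin N → ℝ) i)) := by
    ext; simp [cube]
  rw [this]; exact Measure.univ_pi_Ioo_ae_eq_Icc

lemma cube_ae_eq_Ioc (N : ℕ) : (cube N : Set (Fin N → ℝ)) =ᵐ[volume]
    {x | ∀ i, x i ∈ Ioc ((0 : Fin N → ℝ) i) ((0 : Fin N → ℝ) i + 1)} := by
  refine (cube_ae_eq_Icc N).trans ?_
  have : {x : Fin N → ℝ | ∀ i, x i ∈ Ioc ((0 : Fin N → ℝ) i) ((0 : Fin N → ℝ) i + 1)}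
      = Set.pi univ (fun i => Ioc ((0 : Fin N → ℝ) i) ((1 : Fin N → ℝ) i)) := by
    ext; simp
  rw [this]; exact Measure.univ_pi_Ioc_ae_eq_Icc.symm

lemma restrict_cube (N : ℕ) : (volume.restrict (cube N) : Measure (Fin N → ℝ))
    = volume.restrict (Icc 0 1) := Measure.restrict_congr_set (cube_ae_eq_Icc N)

lemma volume_cube (N : ℕ) : volume (cube N) = 1 := by
  rw [measure_congr (cube_ae_eq_Icc N), Real.volume_Icc_pi]; simp

instance instFiniteCube (N : ℕ) : IsProbabilityMeasure (volume.restrict (cube N)) :=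
  ⟨by rw [Measure.restrict_apply_univ, volume_cube]⟩

/-- Continuous functions belong to every `L^p((0,1)^N)`. -/
lemma memLp_cont {N : ℕ} {φ : (Fin N → ℝ) → ℂ} (hφ : Continuous φ) {p : ℝ≥0∞} :
    MemLp φ p (volume.restrict (cube N)) := by
  obtain ⟨C, hC⟩ := (isCompact_Icc (a := (0 : Fin N → ℝ)) (b := 1)).exists_bound_of_continuousOn
    hφ.continuousOn
  refine MemLp.of_bound hφ.aestronglyMeasurable C ?_
  rw [restrict_cube]
  exact (ae_restrict_iff' measurableSet_Icc).2 (Eventually.of_forall hC)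

lemma integrable_mul_cont {N : ℕ} (f : L2 N) {φ : (Fin N → ℝ) → ℂ} (hφ : Continuous φ) :
    Integrable (fun x => f x * φ x) (volume.restrict (cube N)) :=
  (Lp.memLp f).integrable_mul (memLp_cont (p := 2) hφ)

lemma continuous_pderiv {N : ℕ} {φ : (Fin N → ℝ) → ℂ} (hφ : ContDiff ℝ ∞ φ) (i : Fin N) :
    Continuous (pderiv i φ) :=
  (hφ.continuous_fderiv (by simp)).clm_apply continuous_const

/-- Pairing an `L²` function with a continuous function, as a continuous linear functional. -/
def pairing {N : ℕ} {φ : (Fin N → ℝ) → ℂ} (hφ : Continuous φ) : L2 N →L[ℂ] ℂ :=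
  innerSL ℂ ((memLp_cont (φ := fun x => conj (φ x)) (p := 2)
    (continuous_conj.comp hφ)).toLp _ : L2 N)

lemma pairing_apply {N : ℕ} {φ : (Fin N → ℝ) → ℂ} (hφ : Continuous φ) (f : L2 N) :
    pairing hφ f = ∫ x in cube N, f x * φ x := by
  rw [pairing, innerSL_apply_apply, L2.inner_def]
  refine integral_congr_ae ?_
  filter_upwards [MemLp.coeFn_toLp (memLp_cont (φ := fun x => conj (φ x)) (p := 2) (N := N)
    (continuous_conj.comp hφ))] with x hx
  rw [hx]; simp

lemma ibp_iff {N : ℕ} (p : Pairs N) {φ : (Fin N → ℝ) → ℂ} (hφ : ContDiff ℝ ∞ φ) :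
    IBP p φ ↔ ∀ i, pairing (continuous_pderiv hφ i) (fn p) + pairing hφ.continuous (grad p i) = 0 := by
  simp only [pairing_apply, IBP, eq_neg_iff_add_eq_zero]

/-- The Sobolev space `H¹((0,1)^N)`: pairs `(u, ∇u)` where `∇u ∈ (L²)^N` is the weak gradient
of `u ∈ L²`. -/
def sobolev (N : ℕ) : Submodule ℂ (Pairs N) where
  carrier := {p | ∀ φ, IsTest φ → IBP p φ}
  add_mem' := by
    intro a b ha hb φ hφ
    have ha := (ibp_iff _ hφ.1).1 (ha φ hφ)
    have hb := (ibp_iff _ hφ.1).1 (hb φ hφ)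
    refine (ibp_iff _ hφ.1).2 fun i => ?_
    have := congrArg₂ (· + ·) (ha i) (hb i)
    simp only [PiLp.add_apply, map_add] at this ⊢
    linear_combination this
  zero_mem' := by
    intro φ hφ
    refine (ibp_iff _ hφ.1).2 fun i => ?_
    simp
  smul_mem' := by
    intro c a ha φ hφ
    have ha := (ibp_iff _ hφ.1).1 (ha φ hφ)
    refine (ibp_iff _ hφ.1).2 fun i => ?_
    simp only [map_smul, PiLp.smul_apply, ← smul_add, ha i,
      smul_zero]

/-- The space `H¹(T^N)` of periodic `H¹`-functions: the elements of `H¹((0,1)^N)` for which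
integration by parts against all smooth periodic functions holds without boundary terms. -/
def sobolevPer (N : ℕ) : Submodule ℂ (Pairs N) where
  carrier := {p | p ∈ sobolev N ∧ ∀ φ, IsPeriodicSmooth φ → IBP p φ}
  add_mem' := by
    intro a b ha hb
    refine ⟨add_mem ha.1 hb.1, fun φ hφ => ?_⟩
    have ha := (ibp_iff _ hφ.1).1 (ha.2 φ hφ)
    have hb := (ibp_iff _ hφ.1).1 (hb.2 φ hφ)
    refine (ibp_iff _ hφ.1).2 fun i => ?_
    have := congrArg₂ (· + ·) (ha i) (hb i)
    simp only [PiLp.add_apply, map_add] at this ⊢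
    linear_combination this
  zero_mem' := by
    refine ⟨zero_mem _, fun φ hφ => ?_⟩
    refine (ibp_iff _ hφ.1).2 fun i => ?_
    simp
  smul_mem' := by
    intro c a ha
    refine ⟨Submodule.smul_mem _ _ ha.1, fun φ hφ => ?_⟩
    have ha := (ibp_iff _ hφ.1).1 (ha.2 φ hφ)
    refine (ibp_iff _ hφ.1).2 fun i => ?_
    simp only [map_smul, PiLp.smul_apply, ← smul_add, ha i,
      smul_zero]

lemma isClosed_sobolevPer (N : ℕ) : IsClosed (sobolevPer N : Set (Pairs N)) := by
  have key : ∀ φ : (Fin N → ℝ) → ℂ, ContDiff ℝ ∞ φ → IsClosed {p : Pairs N | IBP p φ} := by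
    intro φ hφ
    simp only [ibp_iff _ hφ, Set.ofPred_forall]
    refine isClosed_iInter fun i => isClosed_eq ?_ continuous_const
    have h1 : Continuous fun p : Pairs N => fn p :=
      fn.continuous
    have h2 : Continuous fun p : Pairs N => grad p :=
      grad.continuous
    have h3 : Continuous fun p : Pairs N => grad p i := (PiLp.continuous_apply 2 _ i).comp h2
    fun_prop
  have : (sobolevPer N : Set (Pairs N)) = (⋂ φ, ⋂ (_ : IsTest φ), {p : Pairs N | IBP p φ}) ∩
      ⋂ φ, ⋂ (_ : IsPeriodicSmooth φ), {p : Pairs N | IBP p φ} := by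
    ext p; simp [sobolevPer, sobolev]
  rw [this]
  exact (isClosed_iInter fun φ => isClosed_iInter fun h => key φ h.1).inter
    (isClosed_iInter fun φ => isClosed_iInter fun h => key φ h.1)

instance instCompletePer (N : ℕ) : CompleteSpace (sobolevPer N) :=
  (isClosed_sobolevPer N).completeSpace_coe

/-- The space `H¹₀((0,1)^N)`: the closure in the `H¹`-norm of the test functions. -/
def sobolevZero (N : ℕ) : Submodule ℂ (Pairs N) :=
  (Submodule.span ℂ {p | ∃ φ, IsTest φ ∧ fn p =ᵐ[volume.restrict (cube N)] φ ∧
    ∀ i, grad p i =ᵐ[volume.restrict (cube N)] pderiv i φ}).topologicalClosure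

/-- The space `Har((0,1)^N)` of (weakly) harmonic functions in `H¹((0,1)^N)`. -/
def har (N : ℕ) : Submodule ℂ (Pairs N) where
  carrier := {u | u ∈ sobolev N ∧ ∀ v ∈ sobolevZero N, inner ℂ (grad v) (grad u) = 0}
  add_mem' := by
    intro a b ha hb
    refine ⟨add_mem ha.1 hb.1, fun v hv => ?_⟩
    rw [map_add, inner_add_right, ha.2 v hv, hb.2 v hv, add_zero]
  zero_mem' := ⟨zero_mem _, fun v _ => by simp⟩
  smul_mem' := by
    intro c a ha
    refine ⟨Submodule.smul_mem _ _ ha.1, fun v hv => ?_⟩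
    rw [map_smul, inner_smul_right, ha.2 v hv, mul_zero]

/-- The space `Har(T^N)` of (weakly) harmonic periodic functions in `H¹(T^N)`. -/
def harPer (N : ℕ) : Submodule ℂ (Pairs N) where
  carrier := {u | u ∈ sobolevPer N ∧ ∀ v ∈ sobolevZero N, inner ℂ (grad v) (grad u) = 0}
  add_mem' := by
    intro a b ha hb
    refine ⟨add_mem ha.1 hb.1, fun v hv => ?_⟩
    rw [map_add, inner_add_right, ha.2 v hv, hb.2 v hv, add_zero]
  zero_mem' := ⟨zero_mem _, fun v _ => by simp⟩
  smul_mem' := by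
    intro c a ha
    refine ⟨Submodule.smul_mem _ _ ha.1, fun v hv => ?_⟩
    rw [map_smul, inner_smul_right, ha.2 v hv, mul_zero]

lemma harPer_le_har (N : ℕ) : harPer N ≤ har N := fun _ hu => ⟨hu.1.1, hu.2⟩

/-- `V = {f ∈ L² : (f | g) = 0 for all g ∈ Har((0,1)^N)}`. -/
def V (N : ℕ) : Submodule ℂ (L2 N) where
  carrier := {f | ∀ g ∈ har N, inner ℂ (fn g) f = 0}
  add_mem' := fun ha hb g hg => by rw [inner_add_right, ha g hg, hb g hg, add_zero]
  zero_mem' := fun g _ => inner_zero_right _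
  smul_mem' := fun c a ha g hg => by rw [inner_smul_right, ha g hg, mul_zero]

/-- `Ṽ = {f ∈ L² : (f | g) = 0 for all g ∈ Har(T^N)}`. -/
def Vtilde (N : ℕ) : Submodule ℂ (L2 N) where
  carrier := {f | ∀ g ∈ harPer N, inner ℂ (fn g) f = 0}
  add_mem' := fun ha hb g hg => by rw [inner_add_right, ha g hg, hb g hg, add_zero]
  zero_mem' := fun g _ => inner_zero_right _
  smul_mem' := fun c a ha g hg => by rw [inner_smul_right, ha g hg, mul_zero]

lemma V_le_Vtilde (N : ℕ) : V N ≤ Vtilde N := fun _ hf g hg => hf g (harPer_le_har N hg)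

/-- `H⁻¹(T^N)`: the bounded antilinear functionals on `H¹(T^N)`. -/
abbrev dualPer (N : ℕ) : Type := sobolevPer N →L⋆[ℂ] ℂ

/-- The embedding `L² ↪ H⁻¹(T^N)` with `L²` as pivot space: `⟨f, v⟩ = ∫ f v̄`. -/
def embedL2 (N : ℕ) : L2 N →ₗ[ℂ] dualPer N where
  toFun f := ((innerSLFlip ℂ f).comp fn).comp (sobolevPer N).subtypeL
  map_add' f g := by ext v; simp
  map_smul' c f := by ext v; simp

lemma embedL2_apply {N : ℕ} (f : L2 N) (v : sobolevPer N) :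
    embedL2 N f v = inner ℂ (fn v.1) f := rfl


/-! ### Constants, and the Poincaré inequality on the torus -/

lemma integral_pderiv_eq_zero {N : ℕ} {φ : (Fin N → ℝ) → ℂ} (hφ : ContDiff ℝ ∞ φ)
    (i : Fin N) (h : ∀ x : Fin N → ℝ, x ∈ Icc (0 : Fin N → ℝ) 1 → x i = 0 →
      φ (x + Pi.single i 1) = φ x) :
    ∫ x in cube N, pderiv i φ x = 0 := by
  cases N with
  | zero => exact i.elim0
  | succ n =>
    rw [restrict_cube]
    have hd : ∀ x, HasFDerivAt φ (fderiv ℝ φ x) x := fun x =>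
      (hφ.differentiable (by simp) x).hasFDerivAt
    have hsum : ∀ x, ∑ j, (if j = i then fderiv ℝ φ x else 0) (Pi.single j (1 : ℝ))
        = pderiv i φ x := by
      intro x
      rw [Finset.sum_eq_single i]
      · simp [pderiv]
      · intro b _ hb; simp [hb]
      · simp
    have := integral_divergence_of_hasFDerivAt_off_countable' (0 : Fin (n + 1) → ℝ) 1 zero_le_one
      (fun j => if j = i then φ else 0) (fun j x => if j = i then fderiv ℝ φ x else 0) ∅
      countable_empty
      (by intro j; split_ifs; exacts [hφ.continuous.continuousOn, continuousOn_const])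
      (by
        intro x _ j
        by_cases hj : j = i
        · simpa [hj] using hd x
        · simp only [hj, if_false]
          exact hasFDerivAt_const (0 : ℂ) x)
      (by
        simp only [hsum]
        exact (continuous_pderiv hφ i).continuousOn.integrableOn_compact isCompact_Icc)
    simp only [hsum] at this
    rw [this]
    refine Finset.sum_eq_zero fun j _ => ?_
    by_cases hj : j = i
    · subst hj
      simp only [if_true]
      rw [sub_eq_zero]
      refine setIntegral_congr_fun measurableSet_Icc fun y hy => ?_
      have hm : j.insertNth (0 : ℝ) y ∈ Icc (0 : Fin (n + 1) → ℝ) 1 := by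
        refine ⟨fun k => ?_, fun k => ?_⟩
        · refine Fin.succAboveCases j ?_ (fun m => ?_) k
          · simp
          · simpa using hy.1 m
        · refine Fin.succAboveCases j ?_ (fun m => ?_) k
          · simp
          · simpa using hy.2 m
      have := h (j.insertNth (0 : ℝ) y) hm (by simp)
      simp only [Pi.one_apply, Pi.zero_apply]
      rw [← this]
      congr 1
      funext k
      refine Fin.succAboveCases j ?_ (fun m => ?_) k
      · simp
      · simp
    · simp [hj]

/-- The constant function `1`, with its gradient `0`. -/
def onePair (N : ℕ) : Pairs N :=
  mkPair ((memLp_const (1 : ℂ)).toLp (fun _ => (1 : ℂ))) 0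

lemma onePair_mem_sobolevPer (N : ℕ) : onePair N ∈ sobolevPer N := by
  have key : ∀ φ : (Fin N → ℝ) → ℂ, ContDiff ℝ ∞ φ → (∀ i, ∀ x ∈ Icc (0 : Fin N → ℝ) 1,
      x i = 0 → φ (x + Pi.single i 1) = φ x) → IBP (onePair N) φ := by
    intro φ hφ h i
    have h1 : ∫ x in cube N, fn (onePair N) x * pderiv i φ x = 0 := by
      rw [← integral_pderiv_eq_zero hφ i (h i)]
      refine integral_congr_ae ?_
      filter_upwards [MemLp.coeFn_toLp (memLp_const (1 : ℂ) (p := 2)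
        (μ := volume.restrict (cube N)))] with x hx
      have hx' : fn (onePair N) x = 1 := hx
      rw [hx', one_mul]
    have h2 : ∫ x in cube N, (grad (onePair N)) i x * φ x = 0 := by
      rw [← pairing_apply hφ.continuous]
      simp [onePair]
    rw [h1, h2, neg_zero]
  refine ⟨fun φ hφ => key φ hφ.1 fun i x hx hxi => ?_, fun φ hφ => key φ hφ.1 fun i x _ _ =>
    hφ.2 x i⟩
  have hz : ∀ y : Fin N → ℝ, y ∉ cube N → φ y = 0 := fun y hy =>
    image_eq_zero_of_notMem_tsupport fun hy' => hy (hφ.2.2 hy')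
  rw [hz x fun hx' => ?_, hz _ fun hx' => ?_]
  · have := (hx' i).2; simp [hxi] at this
  · have := (hx' i).1; simp [hxi] at this

lemma onePair_mem_harPer (N : ℕ) : onePair N ∈ harPer N :=
  ⟨onePair_mem_sobolevPer N, fun v _ => by simp [onePair]⟩

section Fourier

/-- The Haar probability measure on the circle. -/
local instance : MeasureSpace UnitAddCircle := ⟨AddCircle.haarAddCircle⟩

local instance : IsProbabilityMeasure (volume : Measure UnitAddCircle) :=
  inferInstanceAs (IsProbabilityMeasure AddCircle.haarAddCircle)

lemma continuous_toTorus (N : ℕ) :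
    Continuous (fun (x : Fin N → ℝ) => (fun i => (x i : UnitAddCircle) : UnitAddTorus (Fin N))) :=
  continuous_pi fun i => (AddCircle.continuous_mk' (1 : ℝ)).comp (continuous_apply i)

/-- Parseval's identity on the cube. -/
lemma parseval {N : ℕ} (f : L2 N) :
    HasSum (fun k : Fin N → ℤ => ‖∫ x in cube N, f x *
      UnitAddTorus.mFourier (-k) (fun i => (x i : UnitAddCircle))‖ ^ 2) (‖f‖ ^ 2) := by
  classical
  set S := {x : Fin N → ℝ | ∀ i, x i ∈ Ioc ((0 : Fin N → ℝ) i) ((0 : Fin N → ℝ) i + 1)} with hS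
  have hSm : MeasurableSet S := MeasurableSet.univ_pi' (fun i => measurableSet_Ioc)
  have hrS : volume.restrict (cube N) = volume.restrict S :=
    Measure.restrict_congr_set (cube_ae_eq_Ioc N)
  have hmp := UnitAddTorus.measurePreserving_equivPiIoc (0 : Fin N → ℝ)
  have hval : MeasurePreserving (Subtype.val : S → Fin N → ℝ) (Measure.comap Subtype.val volume)
      (volume.restrict S) := ⟨measurable_subtype_coe, map_comap_subtype_coe hSm volume⟩
  have hs : MeasurePreserving (fun y => ((UnitAddTorus.measurableEquivPiIoc (0 : Fin N → ℝ)) y).1)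
      (volume : Measure (UnitAddTorus (Fin N))) (volume.restrict S) := hval.comp hmp
  set s := fun y => ((UnitAddTorus.measurableEquivPiIoc (0 : Fin N → ℝ)) y).1 with hsdef
  have hf : MemLp f 2 (volume.restrict S) := hrS ▸ Lp.memLp f
  have hF : MemLp (fun y => f (s y)) 2 (volume : Measure (UnitAddTorus (Fin N))) :=
    hf.comp_measurePreserving hs
  have hsec : ∀ x ∈ S, s (fun i => (x i : UnitAddCircle)) = x := fun x hx =>
    congrArg Subtype.val
      ((UnitAddTorus.measurableEquivPiIoc (0 : Fin N → ℝ)).apply_symm_apply ⟨x, hx⟩)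
  have hP := UnitAddTorus.hasSum_sq_mFourierCoeff (hF.toLp _)
  have hae := hF.coeFn_toLp
  have e1 : ∫ t, ‖(hF.toLp _) t‖ ^ 2 = ‖f‖ ^ 2 := by
    have : ∫ t, ‖(hF.toLp _) t‖ ^ 2
        = ∫ t : UnitAddTorus (Fin N), ‖f (s t)‖ ^ 2 := by
      refine integral_congr_ae ?_
      filter_upwards [hae] with t ht
      rw [ht]
    rw [this, UnitAddTorus.integral_preimage _ (0 : Fin N → ℝ)]
    rw [setIntegral_congr_fun (g := fun x => ‖f x‖ ^ 2) hSm fun x hx => by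
      simp only [hsec x hx]]
    rw [← hrS]
    have h2 := congrArg Complex.re (L2.inner_def (𝕜 := ℂ) f f)
    rw [inner_self_eq_norm_sq_to_K] at h2
    have h3 : (((‖f‖ : ℂ)) ^ 2).re = ‖f‖ ^ 2 := by
      rw [← Complex.ofReal_pow, Complex.ofReal_re]
    have h4 : ∫ x in cube N, inner ℂ (f x) (f x) = ((∫ x in cube N, ‖f x‖ ^ 2 : ℝ) : ℂ) := by
      rw [← integral_complex_ofReal]
      refine integral_congr_ae (Eventually.of_forall fun x => ?_)
      simp only
      rw [inner_self_eq_norm_sq_to_K]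
      simp
    rw [h4, Complex.ofReal_re] at h2
    rw [← h2]; exact h3
  have e2 : ∀ k, UnitAddTorus.mFourierCoeff (hF.toLp _) k = ∫ x in cube N, f x *
      UnitAddTorus.mFourier (-k) (fun i => (x i : UnitAddCircle)) := by
    intro k
    have : UnitAddTorus.mFourierCoeff (hF.toLp _) k
        = UnitAddTorus.mFourierCoeff (fun y => f (s y)) k := by
      refine integral_congr_ae ?_
      filter_upwards [hae] with t ht
      rw [ht]
    rw [this, UnitAddTorus.mFourierCoeff_eq_integral _ _ (0 : Fin N → ℝ)]
    refine Eq.trans ?_ (congrArg (fun μ => ∫ x, f x *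
      UnitAddTorus.mFourier (-k) (fun i => (x i : UnitAddCircle)) ∂μ) hrS.symm)
    refine setIntegral_congr_fun hSm fun x hx => ?_
    simp only [hsec x hx, smul_eq_mul, mul_comm]
  rw [e1] at hP
  simpa only [e2] using hP

/-- The exponentials on `ℝ^N`. -/
lemma mFourier_eq_exp {N : ℕ} (k : Fin N → ℤ) (x : Fin N → ℝ) :
    UnitAddTorus.mFourier k (fun i => (x i : UnitAddCircle))
      = Complex.exp (∑ i, 2 * Real.pi * Complex.I * k i * x i) := by
  rw [Complex.exp_sum]
  simp only [UnitAddTorus.mFourier, ContinuousMap.coe_mk]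
  refine Finset.prod_congr rfl fun i _ => ?_
  rw [fourier_coe_apply]
  simp

/-- The Poincaré inequality for mean-zero elements of `H¹(T^N)`. -/
lemma poincare {N : ℕ} (p : Pairs N) (hp : p ∈ sobolevPer N) (h0 : ∫ x in cube N, fn p x = 0) :
    ‖fn p‖ ≤ ‖grad p‖ := by
  have hcoef : ∀ (k : Fin N → ℤ) (i : Fin N),
      (2 * Real.pi * Complex.I * k i) * (∫ x in cube N, fn p x *
        UnitAddTorus.mFourier (-k) (fun i => (x i : UnitAddCircle)))
      = ∫ x in cube N, grad p i x *
        UnitAddTorus.mFourier (-k) (fun i => (x i : UnitAddCircle)) := by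
    intro k i
    set L : (Fin N → ℝ) →L[ℝ] ℂ := ∑ j, (2 * Real.pi * Complex.I * (-k) j) •
      (Complex.ofRealCLM.comp (ContinuousLinearMap.proj (R := ℝ) (φ := fun _ : Fin N => ℝ) j))
      with hL
    have hLx : ∀ x, L x = ∑ j, 2 * Real.pi * Complex.I * ((-k) j : ℤ) * x j := by
      intro x; simp [hL]
    have hexp : ∀ x : Fin N → ℝ, UnitAddTorus.mFourier (-k) (fun i => (x i : UnitAddCircle))
        = Complex.exp (L x) := fun x => by rw [mFourier_eq_exp, hLx]
    have hsm : ContDiff ℝ ∞ (fun x => Complex.exp (L x)) := L.contDiff.cexp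
    have hper : IsPeriodicSmooth (fun x => Complex.exp (L x)) := by
      refine ⟨hsm, fun x j => ?_⟩
      simp only [← hexp]
      congr 1
      funext m
      by_cases hm : m = j
      · subst hm
        simp
      · simp [hm]
    have hd : ∀ x, pderiv i (fun x => Complex.exp (L x)) x
        = -(2 * Real.pi * Complex.I * k i) * Complex.exp (L x) := by
      intro x
      have : HasFDerivAt (fun x => Complex.exp (L x)) (Complex.exp (L x) • L) x :=
        L.hasFDerivAt.cexp
      rw [pderiv, this.fderiv]
      simp only [_root_.smul_apply, smul_eq_mul]
      rw [hLx (Pi.single i 1), Finset.sum_eq_single i]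
      · simp; ring
      · intro b _ hb; simp [hb]
      · simp
    have := hp.2 _ hper i
    simp only [hd] at this
    simp only [hexp]
    rw [← integral_const_mul]
    have h2 : ∫ x in cube N, fn p x * (-(2 * Real.pi * Complex.I * k i) * Complex.exp (L x))
        = - ∫ x in cube N, (2 * Real.pi * Complex.I * k i) * (fn p x * Complex.exp (L x)) := by
      rw [← integral_neg]
      congr 1; funext x; ring
    rw [h2, neg_inj] at this
    exact this
  have hsum : HasSum (fun k : Fin N → ℤ => ∑ i, ‖∫ x in cube N, grad p i x *
      UnitAddTorus.mFourier (-k) (fun i => (x i : UnitAddCircle))‖ ^ 2) (∑ i, ‖grad p i‖ ^ 2) :=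
    hasSum_sum fun i _ => parseval (grad p i)
  have hle := hasSum_le (fun k => ?_) (parseval (fn p)) hsum
  · rw [← PiLp.norm_sq_eq_of_L2] at hle
    exact le_of_sq_le_sq hle (norm_nonneg _)
  · by_cases hk : k = 0
    · subst hk
      have : ∫ x in cube N, fn p x *
          UnitAddTorus.mFourier (-0) (fun i => (x i : UnitAddCircle)) = 0 := by
        rw [← h0]; congr 1; funext x; simp [UnitAddTorus.mFourier_zero]
      rw [this]
      simp only [norm_zero, ne_eq, OfNat.ofNat_ne_zero, not_false_eq_true, zero_pow]
      positivity
    · obtain ⟨i, hi⟩ := Function.ne_iff.1 hk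
      refine le_trans ?_ (Finset.single_le_sum (f := fun i => ‖∫ x in cube N, grad p i x *
        UnitAddTorus.mFourier (-k) (fun i => (x i : UnitAddCircle))‖ ^ 2)
        (fun j _ => by positivity) (Finset.mem_univ i))
      simp only [← hcoef k i]
      rw [norm_mul, mul_pow]
      refine le_mul_of_one_le_left (by positivity) ?_
      have h1 : (1 : ℝ) ≤ |(k i : ℝ)| := by
        exact_mod_cast Int.one_le_abs hi
      have h2 : ‖2 * Real.pi * Complex.I * (k i : ℂ)‖ = 2 * Real.pi * |(k i : ℝ)| := by
        simp [abs_of_pos Real.pi_pos]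
      rw [h2]
      have : (1 : ℝ) ≤ 2 * Real.pi := by linarith [Real.pi_gt_three]
      nlinarith [one_le_mul_of_one_le_of_one_le this h1]

end Fourier

/-! ### The Hilbert space `H` -/

/-- The annihilator of `Har(T^N)` in `H⁻¹(T^N)`. -/
def annihilator (N : ℕ) : Submodule ℂ (dualPer N) where
  carrier := {w | ∀ v : sobolevPer N, v.1 ∈ harPer N → w v = 0}
  add_mem' := fun ha hb v hv => by
    rw [_root_.add_apply, ha v hv, hb v hv, add_zero]
  zero_mem' := fun v _ => rfl
  smul_mem' := fun c a ha v hv => by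
    rw [_root_.smul_apply, ha v hv, smul_zero]

/-- The space `H`: the annihilator of `Har(T^N)` in `H⁻¹(T^N)`. It is a type of its own, because
it carries the inner product `(∇u_f | ∇u_g)` defined below, and not the dual norm (the two norms
are equivalent). -/
def HSpace (N : ℕ) : Type := annihilator N

instance instAddCommGroupH (N : ℕ) : AddCommGroup (HSpace N) :=
  inferInstanceAs (AddCommGroup (annihilator N))

instance instModuleH (N : ℕ) : Module ℂ (HSpace N) :=
  inferInstanceAs (Module ℂ (annihilator N))

/-- The functional on `H¹(T^N)` underlying an element of `H`. -/
def HSpace.toDual {N : ℕ} : HSpace N →ₗ[ℂ] dualPer N := (annihilator N).subtype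

lemma HSpace.toDual_injective {N : ℕ} : Function.Injective (HSpace.toDual (N := N)) :=
  (annihilator N).injective_subtype

lemma HSpace.toDual_harPer {N : ℕ} (w : HSpace N) (v : sobolevPer N) (hv : v.1 ∈ harPer N) :
    w.toDual v = 0 := w.2 v hv

lemma integral_eq_pairing {N : ℕ} (f : L2 N) :
    ∫ x in cube N, f x = pairing (φ := fun _ => 1) continuous_const f := by
  simp [pairing_apply]

/-- The space `H¹_m(T^N)` of mean-zero functions in `H¹(T^N)`. -/
def meanZero (N : ℕ) : Submodule ℂ (Pairs N) where
  carrier := {u | u ∈ sobolevPer N ∧ ∫ x in cube N, fn u x = 0}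
  add_mem' := by
    intro a b ha hb
    refine ⟨add_mem ha.1 hb.1, ?_⟩
    have ha := ha.2
    have hb := hb.2
    simp only [integral_eq_pairing, map_add] at *
    rw [ha, hb, add_zero]
  zero_mem' := ⟨zero_mem _, by simp⟩
  smul_mem' := by
    intro c a ha
    refine ⟨Submodule.smul_mem _ _ ha.1, ?_⟩
    have ha := ha.2
    simp only [integral_eq_pairing, map_smul] at *
    rw [ha, smul_zero]

lemma meanZero_complete (N : ℕ) : CompleteSpace (meanZero N) := by
  have : IsClosed (meanZero N : Set (Pairs N)) := by
    have e : (meanZero N : Set (Pairs N)) = (sobolevPer N : Set (Pairs N)) ∩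
        {u | pairing (φ := fun _ => 1) continuous_const (fn u) = 0} := by
      ext u; simp [meanZero, pairing_apply]
    rw [e]
    have h1 : Continuous fun u : Pairs N => fn u :=
      fn.continuous
    exact (isClosed_sobolevPer N).inter (isClosed_eq (by fun_prop) continuous_const)
  exact this.completeSpace_coe

lemma integral_onePair (N : ℕ) : ∫ x in cube N, fn (onePair N) x = 1 := by
  rw [integral_congr_ae (g := fun _ => (1 : ℂ))]
  · simp [measureReal_def]
  · filter_upwards [MemLp.coeFn_toLp (memLp_const (1 : ℂ) (p := 2)
        (μ := volume.restrict (cube N)))] with x hx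
    exact hx

/-- For every `w ∈ H` there is `u ∈ H¹_m(T^N)` with
`∫ ∇u · ∇v̄ = -⟨w, v⟩` for all `v ∈ H¹(T^N)`. -/
lemma exists_potential {N : ℕ} (w : HSpace N) : ∃ u : Pairs N, u ∈ meanZero N ∧
    ∀ v : sobolevPer N, inner ℂ (grad v.1) (grad u) = - w.toDual v := by
  have := meanZero_complete N
  let G : meanZero N →L[ℂ] PiLp 2 (fun _ : Fin N => L2 N) :=
    grad.comp (meanZero N).subtypeL
  have hG : ∀ u : meanZero N, G u = grad u.1 := fun u => rfl
  have hle : meanZero N ≤ sobolevPer N := fun u hu => hu.1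
  let T : meanZero N →L[ℂ] meanZero N :=
    (ContinuousLinearMap.adjoint G).comp G
  have hT : ∀ u v : meanZero N, inner ℂ v (T u) = inner ℂ (grad v.1) (grad u.1) := fun u v => by
    rw [← hG, ← hG, ← ContinuousLinearMap.adjoint_inner_right G v (G u)]
    rfl
  have hunit : IsUnit T := by
    refine ContinuousLinearMap.isUnit_of_forall_le_norm_inner_map T (c := 2⁻¹) (by norm_num) ?_
    intro u
    rw [norm_inner_symm, hT, inner_self_eq_norm_sq_to_K]
    have h1 := poincare u.1 u.2.1 u.2.2
    have h2 : ‖u‖ ^ 2 = ‖fn u.1‖ ^ 2 + ‖grad u.1‖ ^ 2 := norm_sq_pair u.1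
    rw [h2]
    simp only [NNReal.coe_inv, NNReal.coe_ofNat, norm_pow]
    rw [RCLike.norm_ofReal, abs_of_nonneg (norm_nonneg _)]
    nlinarith [norm_nonneg (fn u.1), norm_nonneg (grad u.1)]
  -- Riesz representation of the conjugate of `w` on the mean-zero subspace
  let emb : meanZero N →L[ℂ] sobolevPer N :=
    (meanZero N).subtypeL.codRestrict (sobolevPer N) fun u => hle u.2
  let ℓ : StrongDual ℂ (meanZero N) := (starL ℂ : ℂ ≃L⋆[ℂ] ℂ).toContinuousLinearMap.comp
    (w.toDual.comp emb)
  obtain ⟨m, hm⟩ := (InnerProductSpace.toDual ℂ (meanZero N)).surjective ℓ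
  have hm' : ∀ v : meanZero N, inner ℂ v m = w.toDual (emb v) := fun v => by
    rw [← inner_conj_symm, ← InnerProductSpace.toDual_apply_apply, hm]
    simp [ℓ]
  obtain ⟨S, hS⟩ := hunit.exists_right_inv
  refine ⟨(S (-m)).1, (S (-m)).2, fun v => ?_⟩
  have hTS : T (S (-m)) = -m := by
    have := congrArg (fun F : meanZero N →L[ℂ] meanZero N => F (-m)) hS
    simpa using this
  -- split off the mean of `v`
  set c : ℂ := ∫ x in cube N, fn v.1 x with hc
  have hv0 : v.1 - c • onePair N ∈ meanZero N := by
    refine ⟨sub_mem v.2 (Submodule.smul_mem _ _ (onePair_mem_sobolevPer N)), ?_⟩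
    have h1 := integral_onePair N
    rw [integral_eq_pairing] at h1 hc ⊢
    rw [map_sub, map_smul, map_sub, map_smul, h1, hc]
    simp
  have hw1 : w.toDual ⟨onePair N, onePair_mem_sobolevPer N⟩ = 0 :=
    w.toDual_harPer _ (onePair_mem_harPer N)
  have hv : v = emb ⟨_, hv0⟩ + c • ⟨onePair N, onePair_mem_sobolevPer N⟩ := by
    apply Subtype.ext
    change v.1 = (v.1 - c • onePair N) + c • onePair N
    abel
  have e1 : w.toDual v = w.toDual (emb ⟨_, hv0⟩) := by
    conv_lhs => rw [hv]
    rw [map_add, map_smulₛₗ, hw1, smul_zero, add_zero]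
  have e2 : (grad v.1) = grad (v.1 - c • onePair N) := by
    simp [onePair]
  have e3 := hT (S (-m)) ⟨_, hv0⟩
  rw [e1, e2, ← hm', ← inner_neg_right]
  exact e3.symm.trans (by rw [hTS])

/-- The function `u_w ∈ H¹_m(T^N)` with `div ∇u_w = w`, given (together with its gradient) by
`∫ ∇u_w · ∇v̄ = -⟨w, v⟩` for all `v ∈ H¹(T^N)`. -/
def potential {N : ℕ} (w : HSpace N) : Pairs N := (exists_potential w).choose

lemma potential_mem {N : ℕ} (w : HSpace N) : potential w ∈ meanZero N :=
  (exists_potential w).choose_spec.1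

lemma inner_potential {N : ℕ} (w : HSpace N) (v : sobolevPer N) :
    inner ℂ (grad v.1) (grad (potential w)) = - w.toDual v := (exists_potential w).choose_spec.2 v

/-- `u_w` is uniquely determined. -/
lemma potential_unique {N : ℕ} (w : HSpace N) {u : Pairs N} (hu : u ∈ meanZero N)
    (h : ∀ v : sobolevPer N, inner ℂ (grad v.1) (grad u) = - w.toDual v) : u = potential w := by
  have hd : u - potential w ∈ meanZero N := sub_mem hu (potential_mem w)
  have h1 : grad (u - potential w) = 0 := by
    rw [← inner_self_eq_zero (𝕜 := ℂ)]
    have := h ⟨_, hd.1⟩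
    rw [← inner_potential w, ← sub_eq_zero, ← inner_sub_right] at this
    exact this
  have h2 : fn (u - potential w) = 0 := by
    have := poincare _ hd.1 hd.2
    rw [h1, norm_zero] at this
    exact norm_le_zero_iff.1 this
  rw [← sub_eq_zero, ← norm_eq_zero, ← sq_eq_zero_iff, norm_sq_pair]
  simp only [h1, h2, norm_zero]
  simp

lemma potential_add {N : ℕ} (w z : HSpace N) :
    potential (w + z) = potential w + potential z := by
  refine (potential_unique _ (add_mem (potential_mem w) (potential_mem z)) fun v => ?_).symm
  rw [map_add, inner_add_right, inner_potential, inner_potential, map_add,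
    _root_.add_apply, neg_add]

lemma potential_smul {N : ℕ} (c : ℂ) (w : HSpace N) :
    potential (c • w) = c • potential w := by
  refine (potential_unique _ (Submodule.smul_mem _ c (potential_mem w)) fun v => ?_).symm
  rw [map_smul, inner_smul_right, inner_potential, map_smul, _root_.smul_apply,
    smul_eq_mul, mul_neg]

/-- The inner product `(w | z)_H = ∫ ∇u_w · ∇ū_z` on `H`; in Mathlib's convention the inner product
is antilinear in its first argument, so that this is `inner ℂ z w`. -/
@[reducible] def coreH (N : ℕ) : InnerProductSpace.Core ℂ (HSpace N) where
  inner z w := inner ℂ (grad (potential z)) (grad (potential w))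
  conj_inner_symm _ _ := inner_conj_symm _ _
  re_inner_nonneg _ := inner_self_nonneg
  add_left x y z := by rw [potential_add, map_add, inner_add_left]
  smul_left x y r := by rw [potential_smul, map_smul, inner_smul_left]
  definite x hx := by
    have h0 : (grad (potential x)) = 0 := inner_self_eq_zero.1 hx
    apply HSpace.toDual_injective
    ext v
    have := inner_potential x v
    rw [h0, inner_zero_right] at this
    simpa using this.symm

instance instNormedAddCommGroupH (N : ℕ) : NormedAddCommGroup (HSpace N) :=
  (coreH N).toNormedAddCommGroup

instance instInnerProductSpaceH (N : ℕ) : InnerProductSpace ℂ (HSpace N) :=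
  InnerProductSpace.ofCore (coreH N).toCore

lemma inner_HSpace {N : ℕ} (z w : HSpace N) :
    inner ℂ z w = inner ℂ (grad (potential z)) (grad (potential w)) := rfl

/-! ### The operators `A` and `Ã` -/

/-- The embedding `Ṽ ↪ H`. -/
def embedVtilde (N : ℕ) : Vtilde N →ₗ[ℂ] HSpace N :=
  LinearMap.codRestrict (annihilator N) ((embedL2 N).comp (Vtilde N).subtype)
    fun f v hv => f.2 v.1 hv

/-- The embedding `V ↪ H`. -/
def embedV (N : ℕ) : V N →ₗ[ℂ] HSpace N :=
  (embedVtilde N).comp (Submodule.inclusion (V_le_Vtilde N))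

/-- Let `W` be a subspace of `L²` and `j : W → H` an embedding. This is the graph of the operator
on `H` associated with the form `a(f, h) = ∫ f h̄` with form domain `W`: the set of pairs
`(j f, g)` with `f ∈ W`, `g ∈ H` and `a(f, h) = (g | j h)_H` for all `h ∈ W`. -/
def formGraph {N : ℕ} (W : Submodule ℂ (L2 N)) (j : W →ₗ[ℂ] HSpace N) :
    Set (HSpace N × HSpace N) :=
  {p | ∃ f : W, p.1 = j f ∧
    ∀ h : W, ∫ x in cube N, f.1 x * conj (h.1 x) = inner ℂ (j h) p.2}

/-- The graph of the operator `A`. -/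
def graphA (N : ℕ) : Set (HSpace N × HSpace N) := formGraph (V N) (embedV N)

/-- The graph of the operator `Ã`. -/
def graphAtilde (N : ℕ) : Set (HSpace N × HSpace N) := formGraph (Vtilde N) (embedVtilde N)

/-! ### Operator semigroups -/

section Semigroups

variable {X : Type*} [NormedAddCommGroup X] [NormedSpace ℂ X]

/-- `(T t)_{t ≥ 0}` is a strongly continuous semigroup of bounded linear operators on `X` (values
of `T` at negative times are irrelevant). -/
structure IsC0Semigroup (T : ℝ → X →L[ℂ] X) : Prop where
  zero : T 0 = ContinuousLinearMap.id ℂ X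
  add : ∀ s t : ℝ, 0 ≤ s → 0 ≤ t → T (s + t) = (T s).comp (T t)
  tendsto : ∀ x, Tendsto (fun t => T t x) (𝓝[>] 0) (𝓝 x)

/-- The operator with graph `G` is the (infinitesimal) generator of the semigroup `T`. -/
def IsGenerator (G : Set (X × X)) (T : ℝ → X →L[ℂ] X) : Prop :=
  ∀ x y : X, (x, y) ∈ G ↔ Tendsto (fun t : ℝ => (t : ℂ)⁻¹ • (T t x - x)) (𝓝[>] 0) (𝓝 y)

/-- The open sector of half-angle `θ` around the positive real axis. -/
def sector (θ : ℝ) : Set ℂ := {z | z ≠ 0 ∧ |z.arg| < θ}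

/-- The semigroup `T` is analytic: for some `0 < θ ≤ π/2` it extends to a holomorphic family of
bounded operators on the sector of half-angle `θ`, which satisfies the semigroup law there and is
strongly continuous at `0` on every smaller sector. -/
def IsAnalyticSemigroup (T : ℝ → X →L[ℂ] X) : Prop :=
  ∃ θ : ℝ, 0 < θ ∧ θ ≤ Real.pi / 2 ∧ ∃ S : ℂ → X →L[ℂ] X,
    (∀ t : ℝ, 0 ≤ t → S t = T t) ∧
    (∀ z ∈ sector θ, ∀ w ∈ sector θ, S (z + w) = (S z).comp (S w)) ∧
    DifferentiableOn ℂ S (sector θ) ∧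
    ∀ θ' : ℝ, 0 < θ' → θ' < θ → ∀ x, Tendsto (fun z => S z x) (𝓝[sector θ'] 0) (𝓝 x)

/-- The semigroup `T` is contractive. -/
def IsContractive (T : ℝ → X →L[ℂ] X) : Prop := ∀ t : ℝ, 0 ≤ t → ‖T t‖ ≤ 1

/-- The semigroup `T` is (uniformly) exponentially stable. -/
def IsExponentiallyStable (T : ℝ → X →L[ℂ] X) : Prop :=
  ∃ M ε : ℝ, 0 < ε ∧ ∀ t : ℝ, 0 ≤ t → ‖T t‖ ≤ M * Real.exp (-(ε * t))

end Semigroups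

/-- The negative of the operator with graph `G`. -/
def negGraph {X : Type*} [Neg X] (G : Set (X × X)) : Set (X × X) := {p | (p.1, -p.2) ∈ G}

end MomentHeat

end

namespace MomentHeat

noncomputable section

/-! ### The symbols `s⁻ᵏ e^{-z/s}` -/

/-! Let `W` be `V` or `Ṽ`, with embedding `j : W → H`. The form is just the `L²` inner product of
`W`, so `a(f, h) = (g | j h)_H` for all `h` says `f = j* g`. Hence the graph of the operator
consists of the pairs `(B g, g)` with `B = j j*`: the operator is `B⁻¹` for a bounded positive `B`
(`mem_formGraph_iff`), and only two facts about `H` matter, completeness and density of the range of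
`j`.

Abstractly (`exists_semigroup_of_isPositive`), the semigroup is `exp (-z B⁻¹)`, obtained from the
continuous functional calculus of `B` with symbol `e^{-z/s}`. For `Re z > 0` this symbol extends
continuously by `0` to `s = 0`; at `z = 0` it would in general jump there, so the identity is
prescribed separately. Scalar bounds on the spectrum then give everything: modulus at most `1` gives
contractivity, boundedness of the spectrum gives exponential decay, and a Taylor estimate gives
holomorphy in operator norm. Strong continuity and the generator are checked on the dense range of
`B`, where factors of `s` cancel the singular `1/s`.

Density is where the harmonic functions enter. If `w ∈ H` is orthogonal to `V`, then `u_w` is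
`L²`-orthogonal to `V`, in particular to `Δφ` for every test function `φ`. So `u_w` is harmonic and
periodic, `w` annihilates it, and `‖w‖² = -⟨w, u_w⟩ = 0` (`denseRange_embedVL`). -/

/-- The function `s ↦ s⁻ᵏ exp (-z / s)` on `(0, ∞)`, extended by zero to the real line. -/
def expSymbol (k : ℕ) (z : ℂ) (s : ℝ) : ℂ :=
  if s ≤ 0 then 0 else ((s : ℂ)⁻¹) ^ k * Complex.exp (-z / s)

lemma expSymbol_of_pos {k : ℕ} {z : ℂ} {s : ℝ} (hs : 0 < s) :
    expSymbol k z s = ((s : ℂ)⁻¹) ^ k * Complex.exp (-z / s) := if_neg hs.not_ge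

lemma expSymbol_of_nonpos {k : ℕ} {z : ℂ} {s : ℝ} (hs : s ≤ 0) : expSymbol k z s = 0 := if_pos hs

lemma norm_exp_neg_div (z : ℂ) (s : ℝ) : ‖Complex.exp (-z / s)‖ = Real.exp (-z.re / s) := by
  rw [Complex.norm_exp, Complex.div_ofReal_re, Complex.neg_re]

/-- A single term of the exponential series of `a / s` is at most `e^{a/s}`. This absorbs negative
powers of `s` into the exponential decay. -/
lemma inv_pow_mul_exp_le {a s : ℝ} (ha : 0 < a) (hs : 0 < s) (n : ℕ) :
    s⁻¹ ^ n * Real.exp (-a / s) ≤ n.factorial / a ^ n := by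
  have h := Real.pow_div_factorial_le_exp (a / s) (by positivity) n
  rw [neg_div, Real.exp_neg, ← div_eq_mul_inv, div_le_div_iff₀ (Real.exp_pos _) (by positivity)]
  rw [div_le_iff₀ (by positivity), div_eq_mul_inv, mul_pow, mul_comm, mul_comm (Real.exp _)] at h
  exact h

/-- Absorbing `k + 1` powers of `s⁻¹` instead of `k` leaves a factor `s`, which gives continuity at
`s = 0`. -/
lemma norm_expSymbol_le {k : ℕ} {z : ℂ} {s : ℝ} (hz : 0 < z.re) (hs : 0 ≤ s) :
    ‖expSymbol k z s‖ ≤ (k + 1).factorial / z.re ^ (k + 1) * s := by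
  rcases hs.eq_or_lt with rfl | hs
  · simp [expSymbol_of_nonpos]
  · rw [expSymbol_of_pos hs, norm_mul, norm_exp_neg_div, norm_pow, norm_inv, Complex.norm_real,
      Real.norm_of_nonneg hs.le]
    have h := mul_le_mul_of_nonneg_right (inv_pow_mul_exp_le hz hs (k + 1)) hs.le
    refine le_trans (le_of_eq ?_) h
    rw [pow_succ]
    field_simp

lemma continuous_expSymbol (k : ℕ) {z : ℂ} (hz : 0 < z.re) : Continuous (expSymbol k z) := by
  refine continuous_iff_continuousAt.2 fun s => ?_
  rcases lt_trichotomy s 0 with hs | rfl | hs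
  · have : expSymbol k z =ᶠ[𝓝 s] fun _ => 0 := by
      filter_upwards [Iio_mem_nhds hs] with r hr using expSymbol_of_nonpos (le_of_lt hr)
    exact continuousAt_const.congr this.symm
  · rw [ContinuousAt, expSymbol_of_nonpos le_rfl]
    refine squeeze_zero_norm (a := fun s : ℝ => (k + 1).factorial / z.re ^ (k + 1) * |s|)
      (fun s => ?_) ?_
    · rcases le_total s 0 with hs | hs
      · rw [expSymbol_of_nonpos hs, norm_zero]; positivity
      · rw [abs_of_nonneg hs]; exact norm_expSymbol_le hz hs
    · have : Continuous fun s : ℝ => (k + 1).factorial / z.re ^ (k + 1) * |s| := by fun_prop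
      simpa using this.tendsto 0
  · have : expSymbol k z =ᶠ[𝓝 s] fun s => ((s : ℂ)⁻¹) ^ k * Complex.exp (-z / s) := by
      filter_upwards [Ioi_mem_nhds hs] with r hr using expSymbol_of_pos hr
    refine ContinuousAt.congr ?_ this.symm
    have hs' : (s : ℂ) ≠ 0 := by exact_mod_cast hs.ne'
    have hc : ContinuousAt (fun r : ℝ => (r : ℂ)) s := Complex.continuous_ofReal.continuousAt
    exact ((hc.inv₀ hs').pow k).mul (continuousAt_const.div hc hs').cexp

lemma expSymbol_add (z w : ℂ) (s : ℝ) :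
    expSymbol 0 (z + w) s = expSymbol 0 z s * expSymbol 0 w s := by
  rcases le_or_gt s 0 with hs | hs
  · simp [expSymbol_of_nonpos hs]
  · simp only [expSymbol_of_pos hs, pow_zero, one_mul, ← Complex.exp_add]
    congr 1; ring

/-- An upper bound `c` for the spectrum of `B` becomes the decay rate `1 / c`. -/
lemma norm_expSymbol_zero_le {z : ℂ} {s c : ℝ} (hz : 0 ≤ z.re) (hc : s ≤ c) :
    ‖expSymbol 0 z s‖ ≤ Real.exp (-z.re / c) := by
  rcases le_or_gt s 0 with hs | hs
  · simp [expSymbol_of_nonpos hs, Real.exp_nonneg]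
  · rw [expSymbol_of_pos hs, pow_zero, one_mul, norm_exp_neg_div, Real.exp_le_exp, neg_div,
      neg_div, neg_le_neg_iff]
    gcongr

lemma norm_expSymbol_zero_le_one {z : ℂ} (hz : 0 ≤ z.re) (s : ℝ) : ‖expSymbol 0 z s‖ ≤ 1 := by
  refine (norm_expSymbol_zero_le hz (le_max_left s 1)).trans (Real.exp_le_one_iff.2 ?_)
  rw [neg_div, neg_nonpos]
  positivity

/-- Taylor's estimate for `‖w‖ ≤ 1`; for larger `w` the half-plane bound `‖e^{-w}‖ ≤ 1` suffices. -/
lemma norm_exp_neg_sub_one_le {w : ℂ} (hw : 0 ≤ w.re) : ‖Complex.exp (-w) - 1‖ ≤ 2 * ‖w‖ := by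
  rcases le_total ‖w‖ 1 with h | h
  · simpa using Complex.norm_exp_sub_one_le (x := -w) (by simpa using h)
  · have h1 : ‖Complex.exp (-w)‖ ≤ 1 := by
      rw [Complex.norm_exp]; simpa using hw
    have := norm_sub_le (Complex.exp (-w)) 1
    rw [norm_one] at this
    linarith

lemma norm_exp_neg_sub_one_add_le {w : ℂ} (hw : 0 ≤ w.re) :
    ‖Complex.exp (-w) - 1 + w‖ ≤ 3 * ‖w‖ ^ 2 := by
  rcases le_total ‖w‖ 1 with h | h
  · have := Complex.norm_exp_sub_one_sub_id_le (x := -w) (by simpa using h)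
    rw [sub_neg_eq_add, norm_neg] at this
    nlinarith [sq_nonneg ‖w‖]
  · have := norm_add_le (Complex.exp (-w) - 1) w
    nlinarith [norm_exp_neg_sub_one_le hw]

/-- With `w = z / s`, the extra factor `s` cancels the denominator and the bound is uniform in `s`.
This is strong continuity on the range of `B`; the next lemma is its second-order version, used for
the generator. -/
lemma norm_expSymbol_mul_sub_le {z : ℂ} (hz : 0 ≤ z.re) {s : ℝ} (hs : 0 ≤ s) :
    ‖expSymbol 0 z s * s - s‖ ≤ 2 * ‖z‖ := by
  rcases hs.eq_or_lt with rfl | hs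
  · simp
  · have hs' : (s : ℂ) ≠ 0 := by exact_mod_cast hs.ne'
    have h := norm_exp_neg_sub_one_le (w := z / s) (by rw [Complex.div_ofReal_re]; positivity)
    rw [norm_div, Complex.norm_real, Real.norm_of_nonneg hs.le] at h
    rw [expSymbol_of_pos hs, pow_zero, one_mul, ← sub_one_mul, norm_mul, Complex.norm_real,
      Real.norm_of_nonneg hs.le, neg_div]
    calc _ ≤ 2 * (‖z‖ / s) * s := by gcongr
      _ = 2 * ‖z‖ := by field_simp

lemma norm_expSymbol_mul_sub_add_le {z : ℂ} (hz : 0 ≤ z.re) {s : ℝ} (hs : 0 ≤ s) :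
    ‖(expSymbol 0 z s * s - s + z) * s‖ ≤ 3 * ‖z‖ ^ 2 := by
  rcases hs.eq_or_lt with rfl | hs
  · simp
  · have hs' : (s : ℂ) ≠ 0 := by exact_mod_cast hs.ne'
    have h := norm_exp_neg_sub_one_add_le (w := z / s) (by rw [Complex.div_ofReal_re]; positivity)
    rw [norm_div, Complex.norm_real, Real.norm_of_nonneg hs.le] at h
    have e : (expSymbol 0 z s * s - s + z) * s
        = (Complex.exp (-(z / s)) - 1 + z / s) * s ^ 2 := by
      rw [expSymbol_of_pos hs, pow_zero, one_mul, neg_div]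
      field_simp
    rw [e, norm_mul, norm_pow, Complex.norm_real, Real.norm_of_nonneg hs.le]
    calc _ ≤ 3 * (‖z‖ / s) ^ 2 * s ^ 2 := by gcongr
      _ = 3 * ‖z‖ ^ 2 := by field_simp

lemma norm_expSymbol_taylor_le {z h : ℂ} (hz : 0 < z.re) (hh : ‖h‖ ≤ z.re / 2) (s : ℝ) :
    ‖expSymbol 0 (z + h) s - expSymbol 0 z s + h * expSymbol 1 z s‖
      ≤ 2 / (z.re / 2) ^ 2 * ‖h‖ ^ 2 := by
  rcases le_or_gt s 0 with hs | hs
  · simp only [expSymbol_of_nonpos hs, sub_zero, mul_zero, add_zero, norm_zero]; positivity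
  · have hs' : (s : ℂ) ≠ 0 := by exact_mod_cast hs.ne'
    -- Factoring out `e^{-z/s}` leaves the second-order Taylor remainder of `exp` at `-h / s`. Half
    -- of the decay `e^{-Re z / s}` then pays for the growth `e^{‖h‖/s}`, the other half for `s⁻²`.
    have e : expSymbol 0 (z + h) s - expSymbol 0 z s + h * expSymbol 1 z s
        = Complex.exp (-z / s) * (Complex.exp (-h / s)
          - ∑ m ∈ Finset.range 2, (-h / s) ^ m / m.factorial) := by
      simp only [expSymbol_of_pos hs, neg_add, add_div, Complex.exp_add, Finset.sum_range_succ,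
        Finset.sum_range_zero]
      simp
      ring
    have hT := Complex.norm_exp_sub_sum_le_norm_mul_exp (-h / s) 2
    have hb := inv_pow_mul_exp_le (half_pos hz) hs 2
    have hn : ‖-h / (s : ℂ)‖ = ‖h‖ / s := by
      rw [norm_div, norm_neg, Complex.norm_real, Real.norm_of_nonneg hs.le]
    have he : Real.exp (-z.re / s) * Real.exp (‖h‖ / s) ≤ Real.exp (-(z.re / 2) / s) := by
      rw [← Real.exp_add, Real.exp_le_exp, ← add_div]
      gcongr
      linarith
    rw [e, norm_mul, norm_exp_neg_div]
    rw [hn] at hT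
    calc _ ≤ Real.exp (-z.re / s) * ((‖h‖ / s) ^ 2 * Real.exp (‖h‖ / s)) := by gcongr
      _ = ‖h‖ ^ 2 * (s⁻¹ ^ 2 * (Real.exp (-z.re / s) * Real.exp (‖h‖ / s))) := by
        rw [div_eq_mul_inv]; ring
      _ ≤ ‖h‖ ^ 2 * (s⁻¹ ^ 2 * Real.exp (-(z.re / 2) / s)) := by gcongr
      _ ≤ ‖h‖ ^ 2 * (2 / (z.re / 2) ^ 2) := by
        gcongr
        simpa using hb
      _ = _ := mul_comm _ _

/-! ### The semigroup generated by the negative inverse of a positive operator -/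

lemma tendsto_of_dense {ι X : Type*} [NormedAddCommGroup X] [NormedSpace ℂ X] {l : Filter ι}
    {T : ι → X →L[ℂ] X} {C : ℝ} (hT : ∀ᶠ i in l, ‖T i‖ ≤ C) {D : Set X} (hD : Dense D)
    (h : ∀ x ∈ D, Tendsto (fun i => T i x) l (𝓝 x)) (x : X) :
    Tendsto (fun i => T i x) l (𝓝 x) := by
  refine Metric.tendsto_nhds.2 fun ε hε => ?_
  -- `|C| + 1` rather than `C` permits dividing by it even when `C = 0`.
  have hC : 0 < |C| + 1 := by positivity
  obtain ⟨y, hy, hxy⟩ := hD.exists_dist_lt x (ε := ε / 2 / (|C| + 1)) (by positivity)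
  filter_upwards [hT, Metric.tendsto_nhds.1 (h y hy) (ε / 2) (half_pos hε)] with i hi hi'
  have h1 : dist (T i x) (T i y) ≤ |C| * dist x y := by
    rw [dist_eq_norm, dist_eq_norm, ← map_sub]
    exact (T i).le_of_opNorm_le (hi.trans (le_abs_self C)) _
  have h2 := dist_triangle4 (T i x) (T i y) y x
  rw [dist_comm y x] at h2
  have h3 : (|C| + 1) * dist x y < ε / 2 := by
    rwa [lt_div_iff₀ hC, mul_comm] at hxy
  linarith

/-! ### Functional calculus of a bounded positive operator -/

section

variable {X : Type*} [NormedAddCommGroup X] [InnerProductSpace ℂ X] [CompleteSpace X]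

-- Reduces the complex functional calculus of `B` to functions of the real variable `s = Re z ≥ 0`.
open scoped ComplexOrder in
lemma spectrum_of_isPositive {B : X →L[ℂ] X} (hB : B.IsPositive) {z : ℂ}
    (hz : z ∈ spectrum ℂ B) : z = z.re ∧ 0 ≤ z.re := by
  have h0 := (ContinuousLinearMap.nonneg_iff_isPositive B).2 hB
  have h := spectrum_nonneg_of_nonneg h0 hz
  exact ⟨Complex.ext rfl (Complex.nonneg_iff.1 h).2.symm, (Complex.nonneg_iff.1 h).1⟩

/-- The function `f` of a positive operator `B`. -/
def posCalc (B : X →L[ℂ] X) (f : ℝ → ℂ) : X →L[ℂ] X := cfc (fun z : ℂ => f z.re) B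

variable {B : X →L[ℂ] X}

/-- Turns scalar bounds into operator bounds. The factor `‖1‖` is kept so that the trivial space,
where it vanishes, needs no separate treatment. -/
lemma norm_posCalc_le (hB : B.IsPositive) {f : ℝ → ℂ} {c : ℝ} (hc : 0 ≤ c)
    (h : ∀ s, 0 ≤ s → s ≤ ‖B‖ * ‖(1 : X →L[ℂ] X)‖ → ‖f s‖ ≤ c) : ‖posCalc B f‖ ≤ c :=
  norm_cfc_le hc fun z hz => by
    obtain ⟨-, h0⟩ := spectrum_of_isPositive hB hz
    exact h _ h0 ((Complex.re_le_norm z).trans (spectrum.norm_le_norm_mul_of_mem hz))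

lemma posCalc_id (hB : B.IsPositive) : posCalc B (fun s => (s : ℂ)) = B := by
  have := hB.isSelfAdjoint.isStarNormal
  refine (cfc_congr fun z hz => ?_).trans (cfc_id ℂ B)
  exact (spectrum_of_isPositive hB hz).1.symm

lemma posCalc_const (hB : B.IsPositive) (c : ℂ) : posCalc B (fun _ => c) = c • 1 := by
  have := hB.isSelfAdjoint.isStarNormal
  exact (cfc_const c B).trans (Algebra.algebraMap_eq_smul_one c)

lemma posCalc_mul {f g : ℝ → ℂ} (hf : Continuous f) (hg : Continuous g) :
    posCalc B (fun s => f s * g s) = posCalc B f * posCalc B g :=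
  cfc_mul _ _ B (hf.comp continuous_re).continuousOn (hg.comp continuous_re).continuousOn

lemma posCalc_add {f g : ℝ → ℂ} (hf : Continuous f) (hg : Continuous g) :
    posCalc B (fun s => f s + g s) = posCalc B f + posCalc B g :=
  cfc_add B _ _ (hf.comp continuous_re).continuousOn (hg.comp continuous_re).continuousOn

lemma posCalc_sub {f g : ℝ → ℂ} (hf : Continuous f) (hg : Continuous g) :
    posCalc B (fun s => f s - g s) = posCalc B f - posCalc B g :=
  cfc_sub _ _ B (hf.comp continuous_re).continuousOn (hg.comp continuous_re).continuousOn

lemma posCalc_const_mul (c : ℂ) {f : ℝ → ℂ} (hf : Continuous f) :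
    posCalc B (fun s => c * f s) = c • posCalc B f :=
  cfc_const_mul _ _ B (hf.comp continuous_re).continuousOn

/-! ### The family `exp (-z B⁻¹)` -/

variable (B) in
/-- The operator `exp (-z B⁻¹)` for `z = 0` and for `z` in the open right half-plane. -/
def expNegInv (z : ℂ) : X →L[ℂ] X := if z = 0 then 1 else posCalc B (expSymbol 0 z)

lemma expNegInv_zero : expNegInv B 0 = 1 := if_pos rfl

lemma expNegInv_of_re_pos {z : ℂ} (hz : 0 < z.re) : expNegInv B z = posCalc B (expSymbol 0 z) :=
  if_neg fun h => by simp [h] at hz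

lemma expNegInv_add {z w : ℂ} (hz : 0 < z.re) (hw : 0 < w.re) :
    expNegInv B (z + w) = expNegInv B z * expNegInv B w := by
  rw [expNegInv_of_re_pos hz, expNegInv_of_re_pos hw,
    expNegInv_of_re_pos (by rw [Complex.add_re]; positivity),
    ← posCalc_mul (continuous_expSymbol 0 hz) (continuous_expSymbol 0 hw)]
  exact congrArg _ (funext fun s => expSymbol_add z w s)

lemma norm_expNegInv_le_one (hB : B.IsPositive) {z : ℂ} (hz : 0 < z.re) :
    ‖expNegInv B z‖ ≤ 1 := by
  rw [expNegInv_of_re_pos hz]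
  exact norm_posCalc_le hB zero_le_one fun s _ _ => norm_expSymbol_zero_le_one hz.le s

/-- The `+ 1` keeps the denominator positive even for `B = 0`, at the price of a slightly smaller
rate. -/
lemma norm_expNegInv_le_exp (hB : B.IsPositive) {z : ℂ} (hz : 0 < z.re) :
    ‖expNegInv B z‖ ≤ Real.exp (-z.re / (‖B‖ * ‖(1 : X →L[ℂ] X)‖ + 1)) := by
  rw [expNegInv_of_re_pos hz]
  exact norm_posCalc_le hB (Real.exp_nonneg _) fun s _ hs =>
    norm_expSymbol_zero_le hz.le (by linarith)

lemma commute_expNegInv (hB : B.IsPositive) {z : ℂ} (hz : 0 < z.re) :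
    Commute (expNegInv B z) B := by
  rw [expNegInv_of_re_pos hz]
  nth_rewrite 2 [← posCalc_id hB]
  exact cfc_commute_cfc _ _ B

lemma expNegInv_mul_sub (hB : B.IsPositive) {z : ℂ} (hz : 0 < z.re) :
    expNegInv B z * B - B = posCalc B fun s => expSymbol 0 z s * s - s := by
  have hc := continuous_expSymbol 0 hz
  rw [posCalc_sub (by fun_prop) (by fun_prop), posCalc_mul hc (by fun_prop), posCalc_id hB,
    expNegInv_of_re_pos hz]

lemma norm_expNegInv_mul_sub_le (hB : B.IsPositive) {z : ℂ} (hz : 0 < z.re) :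
    ‖expNegInv B z * B - B‖ ≤ 2 * ‖z‖ := by
  rw [expNegInv_mul_sub hB hz]
  exact norm_posCalc_le hB (by positivity) fun s hs _ => norm_expSymbol_mul_sub_le hz.le hs

lemma norm_expNegInv_mul_sub_add_le (hB : B.IsPositive) {z : ℂ} (hz : 0 < z.re) :
    ‖(expNegInv B z * B - B + z • 1) * B‖ ≤ 3 * ‖z‖ ^ 2 := by
  have hc := continuous_expSymbol 0 hz
  have e : (expNegInv B z * B - B + z • 1) * B
      = posCalc B fun s => (expSymbol 0 z s * s - s + z) * s := by
    rw [posCalc_mul (by fun_prop) (by fun_prop), posCalc_add (by fun_prop) (by fun_prop),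
      posCalc_id hB, posCalc_const hB, expNegInv_mul_sub hB hz]
  rw [e]
  exact norm_posCalc_le hB (by positivity) fun s hs _ => norm_expSymbol_mul_sub_add_le hz.le hs

/-- The Taylor bound on the symbols is uniform in `s`, so the remainder is `O(‖h‖²)` in operator
norm. -/
lemma hasDerivAt_expNegInv (hB : B.IsPositive) {z : ℂ} (hz : 0 < z.re) :
    HasDerivAt (expNegInv B) (-posCalc B (expSymbol 1 z)) z := by
  rw [hasDerivAt_iff_isLittleO_nhds_zero]
  refine Asymptotics.IsBigO.trans_isLittleO (g := fun h : ℂ => h ^ 2) ?_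
    (Asymptotics.isLittleO_pow_id one_lt_two)
  refine Asymptotics.IsBigO.of_bound (2 / (z.re / 2) ^ 2) ?_
  filter_upwards [Metric.ball_mem_nhds (0 : ℂ) (half_pos hz)] with h hh
  rw [mem_ball_zero_iff] at hh
  have hzh : 0 < (z + h).re := by
    have := (abs_le.1 ((Complex.abs_re_le_norm h).trans hh.le)).1
    rw [Complex.add_re]; linarith
  have e : expNegInv B (z + h) - expNegInv B z - h • -posCalc B (expSymbol 1 z)
      = posCalc B fun s => expSymbol 0 (z + h) s - expSymbol 0 z s + h * expSymbol 1 z s := by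
    have h0 := continuous_expSymbol 0 hz
    have h1 := continuous_expSymbol 1 hz
    have h2 := continuous_expSymbol 0 hzh
    rw [posCalc_add (by fun_prop) (by fun_prop), posCalc_sub h2 h0, posCalc_const_mul _ h1,
      expNegInv_of_re_pos hz, expNegInv_of_re_pos hzh, smul_neg, sub_neg_eq_add]
  rw [e, norm_pow]
  exact norm_posCalc_le hB (by positivity) fun s _ _ => norm_expSymbol_taylor_le hz hh.le s

/-- The operators are contractions, so the range of `B` suffices, and there the error is at most `2
‖z‖ ‖v‖`. The general filter serves both `t ↓ 0` and the sectors. -/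
lemma tendsto_expNegInv (hB : B.IsPositive) (hd : DenseRange B) {l : Filter ℂ}
    (hl : l ≤ 𝓝 0) (hre : ∀ᶠ z in l, 0 < z.re) (x : X) :
    Tendsto (fun z => expNegInv B z x) l (𝓝 x) := by
  refine tendsto_of_dense (T := expNegInv B) (C := 1) ?_ hd ?_ x
  · filter_upwards [hre] with z hz using norm_expNegInv_le_one hB hz
  · rintro _ ⟨v, rfl⟩
    rw [tendsto_iff_norm_sub_tendsto_zero]
    refine squeeze_zero' (g := fun z : ℂ => 2 * ‖z‖ * ‖v‖)
      (Eventually.of_forall fun _ => norm_nonneg _) ?_ ?_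
    · filter_upwards [hre] with z hz
      exact (expNegInv B z * B - B).le_of_opNorm_le (norm_expNegInv_mul_sub_le hB hz) v
    · have : Continuous fun z : ℂ => 2 * ‖z‖ * ‖v‖ := by fun_prop
      simpa using (this.tendsto 0).mono_left hl

lemma tendsto_inv_smul_expNegInv (hB : B.IsPositive) (hd : DenseRange B) (y : X) :
    Tendsto (fun t : ℝ => (t : ℂ)⁻¹ • (expNegInv B t (B y) - B y)) (𝓝[>] 0) (𝓝 (-y)) := by
  have hre : ∀ᶠ t : ℝ in 𝓝[>] 0, 0 < t := self_mem_nhdsWithin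
  -- The sign makes the limit the identity. Composed with `B`, the difference quotients are bounded
  -- by `2`, so vectors `y = B v` suffice, where the second-order estimate applies.
  have h := tendsto_of_dense (l := 𝓝[>] (0 : ℝ)) (C := 2)
    (T := fun t : ℝ => -((t : ℂ)⁻¹ • (expNegInv B t * B - B))) ?_ hd ?_ y
  · simpa using h.neg
  · filter_upwards [hre] with t ht
    rw [norm_neg, norm_smul, norm_inv]
    have h := norm_expNegInv_mul_sub_le hB (z := t) (by simpa using ht)
    have ht' : 0 < ‖(t : ℂ)‖ := by simpa using ht.ne'
    rw [inv_mul_le_iff₀ ht']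
    linarith
  · rintro _ ⟨v, rfl⟩
    rw [tendsto_iff_norm_sub_tendsto_zero]
    refine squeeze_zero' (g := fun t : ℝ => 3 * ‖(t : ℂ)‖ * ‖v‖)
      (Eventually.of_forall fun _ => norm_nonneg _) ?_ ?_
    · filter_upwards [hre] with t ht
      have ht' : (t : ℂ) ≠ 0 := by exact_mod_cast ht.ne'
      have h := norm_expNegInv_mul_sub_add_le hB (z := t) (by simpa using ht)
      have e : (-((t : ℂ)⁻¹ • (expNegInv B t * B - B))) (B v) - B v
          = -((t : ℂ)⁻¹ • ((expNegInv B t * B - B + (t : ℂ) • 1) * B) v) := by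
        change -((t : ℂ)⁻¹ • (expNegInv B t (B (B v)) - B (B v))) - B v
          = -((t : ℂ)⁻¹ • (expNegInv B t (B (B v)) - B (B v) + (t : ℂ) • B v))
        rw [smul_add, smul_smul, inv_mul_cancel₀ ht', one_smul, neg_add, sub_eq_add_neg]
      rw [e, norm_neg, norm_smul, norm_inv, inv_mul_le_iff₀ (norm_pos_iff.2 ht')]
      refine (ContinuousLinearMap.le_of_opNorm_le _ h v).trans (le_of_eq ?_)
      ring
    · have : Continuous fun t : ℝ => 3 * ‖(t : ℂ)‖ * ‖v‖ := by fun_prop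
      simpa using (this.tendsto 0).mono_left nhdsWithin_le_nhds

lemma re_pos_of_mem_sector {θ : ℝ} (hθ : θ ≤ Real.pi / 2) {z : ℂ} (hz : z ∈ sector θ) :
    0 < z.re :=
  (Complex.abs_arg_lt_pi_div_two_iff.1 (hz.2.trans_le hθ)).resolve_right hz.1

/-- The negative of the inverse of a positive operator with dense range generates a contractive,
exponentially stable, analytic semigroup. -/
theorem exists_semigroup_of_isPositive (hB : B.IsPositive) (hd : DenseRange B) {G : Set (X × X)}
    (hG : ∀ x y, (x, y) ∈ G ↔ x = B y) :
    ∃ T : ℝ → X →L[ℂ] X, IsC0Semigroup T ∧ IsGenerator (negGraph G) T ∧ IsAnalyticSemigroup T ∧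
      IsContractive T ∧ IsExponentiallyStable T := by
  have hpos : ∀ {t : ℝ}, 0 < t → 0 < (t : ℂ).re := fun h => by simpa using h
  refine ⟨fun t => expNegInv B t, ⟨?_, ?_, ?_⟩, ?_, ?_, ?_, ?_⟩
  · simp only [Complex.ofReal_zero, expNegInv_zero]; rfl
  · intro s t hs ht
    rcases hs.eq_or_lt with rfl | hs
    · simp only [zero_add, Complex.ofReal_zero, expNegInv_zero]; rfl
    rcases ht.eq_or_lt with rfl | ht
    · simp only [add_zero, Complex.ofReal_zero, expNegInv_zero]; rfl
    simp only [Complex.ofReal_add]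
    exact expNegInv_add (hpos hs) (hpos ht)
  · intro x
    have h0 : Tendsto (fun t : ℝ => (t : ℂ)) (𝓝[>] 0) (𝓝 0) := by
      simpa using (Complex.continuous_ofReal.tendsto 0).mono_left nhdsWithin_le_nhds
    refine (tendsto_expNegInv hB hd (l := map (fun t : ℝ => (t : ℂ)) (𝓝[>] 0)) h0 ?_ x).comp
      tendsto_map
    rw [eventually_map]
    filter_upwards [self_mem_nhdsWithin] with t ht using hpos ht
  · intro x y
    change (x, -y) ∈ G ↔ _
    rw [hG]
    constructor
    · rintro rfl
      simpa using tendsto_inv_smul_expNegInv hB hd (-y)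
    -- If the difference quotients at `x` tend to `y`, apply `B`, which commutes with the semigroup:
    -- the images tend to `B y`, but also to `-x` by the limit on the range of `B`. Hence `x = B
    -- (-y)`.
    · intro h
      have h1 := (B.continuous.tendsto y).comp h
      have h2 := (tendsto_inv_smul_expNegInv hB hd x).congr' (f₂ := fun t : ℝ =>
        B ((t : ℂ)⁻¹ • (expNegInv B t x - x))) ?_
      · rw [map_neg, tendsto_nhds_unique h1 h2, neg_neg]
      · filter_upwards [self_mem_nhdsWithin] with t ht
        have := congrArg (fun F : X →L[ℂ] X => F x) (commute_expNegInv hB (hpos ht)).eq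
        change expNegInv B t (B x) = B (expNegInv B t x) at this
        rw [this, map_smul, map_sub]
  · refine ⟨Real.pi / 2, by positivity, le_rfl, expNegInv B, fun t _ => rfl, ?_, ?_, ?_⟩
    · exact fun z hz w hw =>
        expNegInv_add (re_pos_of_mem_sector le_rfl hz) (re_pos_of_mem_sector le_rfl hw)
    · exact fun z hz => (hasDerivAt_expNegInv hB
        (re_pos_of_mem_sector le_rfl hz)).differentiableAt.differentiableWithinAt
    · intro θ _ hθ x
      refine tendsto_expNegInv hB hd nhdsWithin_le_nhds ?_ x
      filter_upwards [self_mem_nhdsWithin] with z hz using re_pos_of_mem_sector hθ.le hz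
  · intro t ht
    rcases ht.eq_or_lt with rfl | ht
    · simp only [Complex.ofReal_zero, expNegInv_zero]
      exact ContinuousLinearMap.norm_id_le
    · exact norm_expNegInv_le_one hB (hpos ht)
  · refine ⟨1, (‖B‖ * ‖(1 : X →L[ℂ] X)‖ + 1)⁻¹, by positivity, fun t ht => ?_⟩
    rcases ht.eq_or_lt with rfl | ht
    · simp only [Complex.ofReal_zero, expNegInv_zero, mul_zero, neg_zero, Real.exp_zero, mul_one]
      exact ContinuousLinearMap.norm_id_le
    · refine (norm_expNegInv_le_exp hB (hpos ht)).trans (le_of_eq ?_)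
      rw [one_mul, Complex.ofReal_re, neg_div, div_eq_inv_mul]

/-- If `j : W → X` is bounded with dense range, then so is `j j*`. -/
lemma denseRange_comp_adjoint {W : Type*} [NormedAddCommGroup W] [InnerProductSpace ℂ W]
    [CompleteSpace W] {j : W →L[ℂ] X} (hj : DenseRange j) :
    DenseRange (j.comp (ContinuousLinearMap.adjoint j)) := by
  have hd : Dense ((j.comp (ContinuousLinearMap.adjoint j)).range : Set X) := by
    rw [Submodule.dense_iff_topologicalClosure_eq_top, Submodule.topologicalClosure_eq_top_iff,
      Submodule.eq_bot_iff]
    intro x hx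
    -- Orthogonality of `x` to `j j* x` reads `‖j* x‖² = 0`, and the kernel of `j*` is orthogonal to
    -- the dense range of `j`.
    have h1 : ContinuousLinearMap.adjoint j x = 0 := by
      rw [← inner_self_eq_zero (𝕜 := ℂ), ContinuousLinearMap.adjoint_inner_right]
      exact (Submodule.mem_orthogonal _ _).1 hx _ ⟨x, rfl⟩
    refine hj.eq_zero_of_inner_right (𝕜 := ℂ) ?_
    intro w
    rw [← ContinuousLinearMap.adjoint_inner_right, h1, inner_zero_right]
  exact hd

end

end

/-! ### The geometry of `H` -/

lemma norm_HSpace {N : ℕ} (w : HSpace N) : ‖w‖ = ‖grad (potential w)‖ := by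
  have h : ‖w‖ ^ 2 = ‖grad (potential w)‖ ^ 2 := by
    rw [← inner_self_eq_norm_sq (𝕜 := ℂ) w, inner_HSpace, inner_self_eq_norm_sq]
  exact (sq_eq_sq₀ (norm_nonneg _) (norm_nonneg _)).1 h

lemma norm_fn_potential_le {N : ℕ} (w : HSpace N) : ‖fn (potential w)‖ ≤ ‖w‖ := by
  rw [norm_HSpace]
  exact poincare _ (potential_mem w).1 (potential_mem w).2

lemma norm_le_norm_potential {N : ℕ} (w : HSpace N) : ‖w‖ ≤ ‖potential w‖ := by
  refine le_of_sq_le_sq ?_ (norm_nonneg _)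
  rw [norm_sq_pair, norm_HSpace]
  nlinarith [sq_nonneg ‖fn (potential w)‖]

lemma norm_potential_le {N : ℕ} (w : HSpace N) : ‖potential w‖ ≤ 2 * ‖w‖ := by
  refine le_of_sq_le_sq ?_ (by positivity)
  rw [norm_sq_pair, ← norm_HSpace]
  nlinarith [norm_fn_potential_le w, norm_nonneg (fn (potential w))]

/-- The conditions on the right are closed. Conversely, any such `u` is the potential of the
functional `v ↦ -∫ ∇u · ∇v̄`, which kills `Har(T^N)` by assumption. -/
lemma range_potential (N : ℕ) : range (potential (N := N))
    = (meanZero N : Set (Pairs N)) ∩ ⋂ v ∈ harPer N, {u | inner ℂ (grad v) (grad u) = 0} := by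
  ext u
  simp only [mem_range, mem_inter_iff, SetLike.mem_coe, mem_iInter, mem_ofPred_eq]
  constructor
  · rintro ⟨w, rfl⟩
    refine ⟨potential_mem w, fun v hv => ?_⟩
    have := inner_potential w ⟨v, hv.1⟩
    rwa [w.toDual_harPer _ hv, neg_zero] at this
  · rintro ⟨hu, h⟩
    let w : dualPer N := -(((innerSLFlip ℂ (grad u)).comp grad).comp (sobolevPer N).subtypeL)
    have hw : ∀ v : sobolevPer N, w v = - inner ℂ (grad v.1) (grad u) := fun v => rfl
    refine ⟨(⟨w, fun v hv => by rw [hw, h _ hv, neg_zero]⟩ : annihilator N), ?_⟩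
    refine (potential_unique _ hu fun v => ?_).symm
    exact (neg_eq_iff_eq_neg.2 (hw v)).symm

lemma isComplete_range_potential (N : ℕ) : IsComplete (range (potential (N := N))) := by
  rw [range_potential]
  have h0 : IsClosed (meanZero N : Set (Pairs N)) := by
    have := meanZero_complete N
    exact (completeSpace_coe_iff_isComplete.1 this).isClosed
  refine (h0.inter (isClosed_biInter fun v _ => isClosed_eq ?_ continuous_const)).isComplete
  exact continuous_const.inner grad.continuous

/-- By Poincaré, `w ↦ u_w` is an isomorphism onto its range, a complete subspace of the pairs. -/
instance instCompleteH (N : ℕ) : CompleteSpace (HSpace N) := by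
  let P : HSpace N →ₗ[ℂ] Pairs N :=
    { toFun := potential, map_add' := potential_add, map_smul' := potential_smul }
  let Q : HSpace N →L[ℂ] Pairs N := P.mkContinuous 2 norm_potential_le
  have ha : AntilipschitzWith 1 Q :=
    AddMonoidHomClass.antilipschitz_of_bound Q fun w => by
      rw [NNReal.coe_one, one_mul]; exact norm_le_norm_potential w
  exact (completeSpace_iff_isComplete_range (ha.isUniformInducing Q.uniformContinuous)).2
    (isComplete_range_potential N)

/-! ### The embeddings of the form domains -/

/-- The defining identity of the potential of `f`, tested with `v = u_w`. It converts orthogonality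
in `H` into orthogonality in `L²`. -/
lemma inner_embedVtilde {N : ℕ} (w : HSpace N) (f : Vtilde N) :
    inner ℂ w (embedVtilde N f) = - inner ℂ (fn (potential w)) f.1 :=
  inner_potential (embedVtilde N f) ⟨potential w, (potential_mem w).1⟩

lemma norm_embedVtilde_le {N : ℕ} (f : Vtilde N) : ‖embedVtilde N f‖ ≤ 1 * ‖f‖ := by
  rw [one_mul]
  rcases (norm_nonneg (embedVtilde N f)).eq_or_lt with h | h
  · rw [← h]; exact norm_nonneg _
  -- Take `w = f` in the previous identity and use Cauchy–Schwarz and Poincaré.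
  · have h1 : ‖embedVtilde N f‖ ^ 2 ≤ ‖embedVtilde N f‖ * ‖f‖ := by
      have h2 := inner_embedVtilde (embedVtilde N f) f
      have h3 : ‖inner ℂ (embedVtilde N f) (embedVtilde N f)‖ = ‖embedVtilde N f‖ ^ 2 := by
        rw [inner_self_eq_norm_sq_to_K]; simp
      rw [← h3, h2, norm_neg]
      exact (norm_inner_le_norm _ _).trans
        (mul_le_mul_of_nonneg_right (norm_fn_potential_le _) (norm_nonneg _))
    rw [sq] at h1
    exact le_of_mul_le_mul_left h1 h

/-- The bounded embedding `Ṽ ↪ H`. -/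
noncomputable def embedVtildeL (N : ℕ) : Vtilde N →L[ℂ] HSpace N :=
  (embedVtilde N).mkContinuous 1 norm_embedVtilde_le

/-- The bounded embedding `V ↪ H`. -/
noncomputable def embedVL (N : ℕ) : V N →L[ℂ] HSpace N :=
  (embedV N).mkContinuous 1 fun f => norm_embedVtilde_le (Submodule.inclusion (V_le_Vtilde N) f)

/-- As an orthogonal complement the form domain is complete, so the adjoint of its embedding exists.
-/
lemma V_eq_orthogonal (N : ℕ) :
    V N = ((har N).map (fn : Pairs N →L[ℂ] L2 N).toLinearMap)ᗮ := by
  ext f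
  rw [Submodule.mem_orthogonal]
  exact ⟨fun h => by rintro _ ⟨g, hg, rfl⟩; exact h g hg, fun h g hg => h _ ⟨g, hg, rfl⟩⟩

lemma Vtilde_eq_orthogonal (N : ℕ) :
    Vtilde N = ((harPer N).map (fn : Pairs N →L[ℂ] L2 N).toLinearMap)ᗮ := by
  ext f
  rw [Submodule.mem_orthogonal]
  exact ⟨fun h => by rintro _ ⟨g, hg, rfl⟩; exact h g hg, fun h g hg => h _ ⟨g, hg, rfl⟩⟩

instance instCompleteV (N : ℕ) : CompleteSpace (V N) := by
  rw [V_eq_orthogonal]; infer_instance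

instance instCompleteVtilde (N : ℕ) : CompleteSpace (Vtilde N) := by
  rw [Vtilde_eq_orthogonal]; infer_instance

/-! ### Density of `V` in `H` -/

lemma IsTest.conj_pderiv {N : ℕ} {φ : (Fin N → ℝ) → ℂ} (hφ : IsTest φ) (i : Fin N) :
    IsTest fun x => conj (pderiv i φ x) := by
  have hs : ContDiff ℝ ∞ (pderiv i φ) :=
    (hφ.1.fderiv_right (by simp)).clm_apply contDiff_const
  have hsupp : tsupport (fun x => conj (pderiv i φ x)) ⊆ tsupport φ := by
    refine closure_minimal (fun x hx => ?_) (isClosed_tsupport φ)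
    by_contra hx'
    refine hx ?_
    have h0 : fderiv ℝ φ x = 0 := by
      by_contra h
      exact hx' (support_fderiv_subset ℝ h)
    simp [pderiv, h0]
  exact ⟨Complex.conjCLE.contDiff.comp hs,
    hφ.2.1.of_isClosed_subset (isClosed_tsupport _) hsupp, hsupp.trans hφ.2.2⟩

/-- The Laplacian of a test function, as an element of `L²`, represents minus the Dirichlet form
on `H¹((0,1)^N)`. -/
lemma exists_laplacian {N : ℕ} {φ : (Fin N → ℝ) → ℂ} (hφ : IsTest φ) {p : Pairs N}
    (hp : ∀ i, grad p i =ᵐ[volume.restrict (cube N)] pderiv i φ) :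
    ∃ f : L2 N, ∀ u ∈ sobolev N, inner ℂ f (fn u) = - inner ℂ (grad p) (grad u) := by
  have hψ := fun i => hφ.conj_pderiv i
  -- The summands are `∂ᵢ²φ`, written as the conjugate of `∂ᵢ` of the test function `conj (∂ᵢ φ)`.
  -- The inner product with them is then an integration by parts pairing.
  refine ⟨∑ i, (memLp_cont (p := 2) (Complex.continuous_conj.comp
    (continuous_pderiv (hψ i).1 i))).toLp _, fun u hu => ?_⟩
  rw [sum_inner, PiLp.inner_apply, ← Finset.sum_neg_distrib]
  refine Finset.sum_congr rfl fun i _ => ?_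
  have h := (ibp_iff u (hψ i).1).1 (hu _ (hψ i)) i
  have e : (memLp_cont (p := 2) (Complex.continuous_conj.comp (hψ i).1.continuous)).toLp _
      = grad p i := by
    refine Lp.ext ((MemLp.coeFn_toLp _).trans ?_)
    filter_upwards [hp i] with x hx
    simp [hx]
  have h2 : pairing (hψ i).1.continuous (grad u i) = inner ℂ (grad p i) (grad u i) := by
    rw [← e]; rfl
  rw [← h2]
  exact eq_neg_of_add_eq_zero_left h

/-- For a test function `φ`, `Δφ` lies in `V`, since harmonic functions have zero Dirichlet product
with `φ`. Orthogonality of `u` to `Δφ` thus says that `u` is harmonic against `φ`, and this closed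
linear condition `K` extends to `H¹₀`. -/
lemma mem_harPer_of_orthogonal {N : ℕ} {u : Pairs N} (hu : u ∈ sobolevPer N)
    (h : ∀ f ∈ V N, inner ℂ (fn u) f = 0) : u ∈ harPer N := by
  refine ⟨hu, ?_⟩
  let K : Submodule ℂ (Pairs N) := ((Submodule.span ℂ {grad u})ᗮ).comap
    (grad : Pairs N →L[ℂ] PiLp 2 (fun _ : Fin N => L2 N)).toLinearMap
  have hK : IsClosed (K : Set (Pairs N)) :=
    (Submodule.isClosed_orthogonal _).preimage (grad : Pairs N →L[ℂ] _).continuous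
  have hmem : ∀ v, v ∈ K ↔ inner ℂ (grad v) (grad u) = 0 := fun v =>
    Submodule.mem_orthogonal_singleton_iff_inner_left
  suffices hle : sobolevZero N ≤ K from fun v hv => (hmem v).1 (hle hv)
  refine Submodule.topologicalClosure_minimal _ (Submodule.span_le.2 ?_) hK
  rintro p ⟨φ, hφ, hp, hgp⟩
  have hp0 : p ∈ sobolevZero N :=
    Submodule.le_topologicalClosure _ (Submodule.subset_span ⟨φ, hφ, hp, hgp⟩)
  obtain ⟨f, hf⟩ := exists_laplacian hφ hgp
  have hfV : f ∈ V N := fun g hg => by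
    rw [inner_eq_zero_symm, hf g hg.1, hg.2 p hp0, neg_zero]
  have := hf u hu.1
  rw [inner_eq_zero_symm.1 (h f hfV)] at this
  exact (hmem p).2 (neg_eq_zero.1 this.symm)

lemma denseRange_embedVL (N : ℕ) : DenseRange (embedVL N) := by
  have hd : Dense ((embedVL N).range : Set (HSpace N)) := by
    rw [Submodule.dense_iff_topologicalClosure_eq_top, Submodule.topologicalClosure_eq_top_iff,
      Submodule.eq_bot_iff]
    intro w hw
    have hu : potential w ∈ harPer N := by
      refine mem_harPer_of_orthogonal (potential_mem w).1 fun f hf => ?_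
      have h1 : inner ℂ w (embedVL N ⟨f, hf⟩) = 0 :=
        (Submodule.mem_orthogonal' _ _).1 hw _ ⟨⟨f, hf⟩, rfl⟩
      have h2 := inner_embedVtilde w ⟨f, V_le_Vtilde N hf⟩
      exact neg_eq_zero.1 (h2.symm.trans h1)
    rw [← inner_self_eq_zero (𝕜 := ℂ), inner_HSpace]
    have h := inner_potential w ⟨potential w, (potential_mem w).1⟩
    rwa [w.toDual_harPer _ hu, neg_zero] at h
  exact hd

lemma denseRange_embedVtildeL (N : ℕ) : DenseRange (embedVtildeL N) := by
  refine (denseRange_embedVL N).mono ?_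
  rintro _ ⟨f, rfl⟩
  exact ⟨Submodule.inclusion (V_le_Vtilde N) f, rfl⟩

/-! ### The operators associated with the form -/

/-- The operator associated with the form is the inverse of `j j*`. -/
lemma mem_formGraph_iff {N : ℕ} {W : Submodule ℂ (L2 N)} [CompleteSpace W]
    (j : W →L[ℂ] HSpace N) (x y : HSpace N) :
    (x, y) ∈ formGraph W (j : W →ₗ[ℂ] HSpace N)
      ↔ x = (j.comp (ContinuousLinearMap.adjoint j)) y := by
  -- The form is the inner product of `W`, so the relation defining the operator is the one
  -- characterizing `j* y`.
  have hform : ∀ f h : W, ∫ x in cube N, f.1 x * conj (h.1 x) = inner ℂ h f := fun f h => by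
    rw [Submodule.coe_inner, L2.inner_def]
    rfl
  constructor
  · rintro ⟨f, rfl, hf⟩
    have : f = ContinuousLinearMap.adjoint j y := ext_inner_left ℂ fun h => by
      rw [ContinuousLinearMap.adjoint_inner_right, ← hform]
      exact hf h
    simp [← this]
  · rintro rfl
    refine ⟨ContinuousLinearMap.adjoint j y, rfl, fun h => ?_⟩
    rw [hform, ContinuousLinearMap.adjoint_inner_right]
    rfl

/-- The negative of the operator associated with the form generates an analytic, contractive and
exponentially stable semigroup as soon as the form domain is dense in `H`. -/
theorem exists_semigroup_formGraph {N : ℕ} {W : Submodule ℂ (L2 N)} [CompleteSpace W]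
    (j : W →L[ℂ] HSpace N) (hj : DenseRange j) :
    ∃ T : ℝ → HSpace N →L[ℂ] HSpace N, IsC0Semigroup T ∧
      IsGenerator (negGraph (formGraph W (j : W →ₗ[ℂ] HSpace N))) T ∧ IsAnalyticSemigroup T ∧
      IsContractive T ∧ IsExponentiallyStable T :=
  exists_semigroup_of_isPositive (ContinuousLinearMap.isPositive_self_comp_adjoint j)
    (denseRange_comp_adjoint hj) (mem_formGraph_iff j)

end MomentHeat

theorem mainTheorem4 (N : ℕ) (hN : 1 ≤ N) :
    (∃ T : ℝ → MomentHeat.HSpace N →L[ℂ] MomentHeat.HSpace N,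
      MomentHeat.IsC0Semigroup T ∧
      MomentHeat.IsGenerator (MomentHeat.negGraph (MomentHeat.graphA N)) T ∧
      MomentHeat.IsAnalyticSemigroup T ∧
      MomentHeat.IsContractive T ∧
      MomentHeat.IsExponentiallyStable T) ∧
    (∃ T : ℝ → MomentHeat.HSpace N →L[ℂ] MomentHeat.HSpace N,
      MomentHeat.IsC0Semigroup T ∧
      MomentHeat.IsGenerator (MomentHeat.negGraph (MomentHeat.graphAtilde N)) T ∧
      MomentHeat.IsAnalyticSemigroup T ∧
      MomentHeat.IsContractive T ∧
      MomentHeat.IsExponentiallyStable T) :=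
  ⟨MomentHeat.exists_semigroup_formGraph _ (MomentHeat.denseRange_embedVL N),
    MomentHeat.exists_semigroup_formGraph _ (MomentHeat.denseRange_embedVtildeL N)⟩
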